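/- Let $\mathbb G=(V,E)$ be a contextuality scenario: $V$ is a finite set and $E$ is a non-empty set of subsets of $V$ (the hyperedges) with $\bigcup_{e\in E}e=V$. A probabilistic model of $\mathbb G$ is a function $p:V\to[0,1]$ with $\sum_{x\in e}p(x)=1$ for all $e\in E$; let $\mathcal G(\mathbb G)$ be the set of all probabilistic models, and assume that $\mathcal G(\mathbb G)\neq\emptyset$ (that is, $\mathbb G$ is non-trivial). Let $\mathcal C(\mathbb G)$ be the set of classical models, i.e. convex combinations of $\{0,1\}$-valued probabilistic models, and let $\mathcal Q(\mathbb G)$ be the set of quantum models, i.e. functions $p(x)=\langle P_x\psi,\psi\rangle$, where $\psi$ is a unit vector in a Hilbert space $H$ and $(P_x)_{x\in V}$ are orthogonal projections on $H$ with $\sum_{x\in e}P_x=I$ for all $e\in E$. Define three operator systems with generators indexed by $V$. * Let $\mathcal S=\bigoplus_{e\in E}\ell^\infty_e$, let $\langle p,u\rangle=\sum_{e\in E}\sum_{x\in e}p(x)u^e_x$ for $u\in\mathcal S$, and let $\tilde{\mathcal J}=\{u\in\mathcal S:\langle p,u\rangle=0\text{ for all }p\in\mathcal G(\mathbb G)\}$.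 Then $\mathcal S_{\mathbb G}=\mathcal S/\tilde{\mathcal J}$ is the operator system quotient (an element of $M_n(\mathcal S/\tilde{\mathcal J})$ is positive iff, for every $r>0$, its sum with $r1$ has a positive lift in $M_n(\mathcal S)$), with generators $a_x=|E|\,(\delta^e_x+\tilde{\mathcal J})$ for any $e\ni x$. * Let $C^*(\mathbb G)$ be the universal unital C*-algebra generated by projections $p_x$, $x\in V$, with $\sum_{x\in e}p_x=1$ for all $e\in E$. Then $\mathcal T_{\mathbb G}=\mathrm{span}\{p_x:x\in V\}$, as an operator subsystem of $C^*(\mathbb G)$. * Let $\mathcal D_{\mathbb G}$ be the quotient of the abelian C*-algebra $\bigotimes_{e\in E}\ell^\infty_e$ by the ideal generated by the differences of the canonical images of $\delta^e_x$ and $\delta^f_x$, for $e,f\in E$, $x\in e\cap f$, and let $d_x$ be the image of $\delta^e_x$ (for any $e\ni x$) in $\mathcal D_{\mathbb G}$. Then $\mathcal R_{\mathbb G}=\mathrm{span}\{d_x:x\in V\}$, as an operator subsystem of $\mathcal D_{\mathbb G}$. For an operator system (or Archimedean order unit space) $W$, let $\mathrm{OMIN}(W)$ be the minimal operator system structure on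 $W$: a matrix $(w_{ij})\in M_n(W)$ is positive iff $\sum_{i,j}\overline{\lambda_i}\lambda_j w_{ij}\in W^+$ for all $\lambda\in\mathbb C^n$. The zero space is admitted as an operator system. Equality of two of these operator systems means that there is a unital complete order isomorphism between them that maps, for every $x\in V$, the generator with index $x$ to the generator with index $x$. Then: 1. $\mathcal G(\mathbb G)=\mathcal Q(\mathbb G)$ if and only if $\mathrm{OMIN}(\mathcal S_{\mathbb G})=\mathrm{OMIN}(\mathcal T_{\mathbb G})$; 2. $\mathcal Q(\mathbb G)=\mathcal C(\mathbb G)$ if and only if $\mathrm{OMIN}(\mathcal T_{\mathbb G})=\mathcal R_{\mathbb G}$; 3. $\mathcal C(\mathbb G)=\mathcal G(\mathbb G)$ if and only if $\mathcal R_{\mathbb G}=\mathrm{OMIN}(\mathcal S_{\mathbb G})$. -/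

import Mathlib

set_option linter.unusedSectionVars false

universe u

open scoped ComplexOrder

/-! ### Abstract operator systems -/

namespace OperatorSystem

section MatrixAux

variable {S T : Type*} [AddCommGroup S] [Module ℂ S] [AddCommGroup T] [Module ℂ T]

/-- `T* a T` for a matrix `a` over a complex vector space and a scalar matrix `T`. -/
def compress {n m : ℕ} (T : Matrix (Fin n) (Fin m) ℂ) (a : Matrix (Fin n) (Fin n) S) :
    Matrix (Fin m) (Fin m) S :=
  Matrix.of fun i j => ∑ k, ∑ l, (star (T k i) * T l j) • a k l

/-- `λ* a λ` for a matrix `a` over a complex vector space and a column `λ`. -/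
def quad {n : ℕ} (a : Matrix (Fin n) (Fin n) S) (l : Fin n → ℂ) : S :=
  ∑ i, ∑ j, (star (l i) * l j) • a i j

/-- The diagonal matrix with all diagonal entries equal to `s`. -/
def diag (n : ℕ) (s : S) : Matrix (Fin n) (Fin n) S := Matrix.diagonal fun _ => s

/-- The one by one matrix with entry `s`. -/
def single (s : S) : Matrix (Fin 1) (Fin 1) S := Matrix.of fun _ _ => s

theorem compress_add {n m : ℕ} (t : Matrix (Fin n) (Fin m) ℂ) (a b : Matrix (Fin n) (Fin n) S) :
    compress t (a + b) = compress t a + compress t b := by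
  ext i j
  simp [compress, smul_add, Finset.sum_add_distrib]

theorem compress_smul {n m : ℕ} (t : Matrix (Fin n) (Fin m) ℂ) (z : ℂ)
    (a : Matrix (Fin n) (Fin n) S) : compress t (z • a) = z • compress t a := by
  ext i j
  simp [compress, Finset.smul_sum, smul_comm z]

theorem compress_neg {n m : ℕ} (t : Matrix (Fin n) (Fin m) ℂ)
    (a : Matrix (Fin n) (Fin n) S) : compress t (-a) = -compress t a := by
  ext i j
  simp [compress]

theorem compress_map {n m : ℕ} (t : Matrix (Fin n) (Fin m) ℂ) (f : S →ₗ[ℂ] T)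
    (a : Matrix (Fin n) (Fin n) S) : (compress t a).map f = compress t (a.map f) := by
  ext i j
  simp [compress]

theorem compress_col {n : ℕ} (l : Fin n → ℂ) (a : Matrix (Fin n) (Fin n) S) :
    compress (Matrix.of fun i (_ : Fin 1) => l i) a = single (quad a l) := by
  ext i j
  simp [compress, single, quad]

theorem compress_diag {n m : ℕ} (t : Matrix (Fin n) (Fin m) ℂ) (s : S) (i j : Fin m) :
    compress t (diag n s) i j = (∑ k, star (t k i) * t k j) • s := by
  simp [compress, diag, Matrix.diagonal_apply, Finset.sum_smul]

theorem quad_add {n : ℕ} (a b : Matrix (Fin n) (Fin n) S) (l : Fin n → ℂ) :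
    quad (a + b) l = quad a l + quad b l := by
  simp [quad, smul_add, Finset.sum_add_distrib]

theorem quad_smul {n : ℕ} (z : ℂ) (a : Matrix (Fin n) (Fin n) S) (l : Fin n → ℂ) :
    quad (z • a) l = z • quad a l := by
  simp [quad, Finset.smul_sum, smul_comm z]

theorem quad_neg {n : ℕ} (a : Matrix (Fin n) (Fin n) S) (l : Fin n → ℂ) :
    quad (-a) l = -quad a l := by
  simp [quad]

theorem quad_map {n : ℕ} (f : S →ₗ[ℂ] T) (a : Matrix (Fin n) (Fin n) S) (l : Fin n → ℂ) :
    quad (a.map f) l = f (quad a l) := by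
  simp [quad]

theorem quad_diag {n : ℕ} (s : S) (l : Fin n → ℂ) :
    quad (diag n s) l = ((∑ i, ‖l i‖ ^ 2 : ℝ) : ℂ) • s := by
  simp only [quad, diag, Matrix.diagonal_apply, smul_ite, smul_zero, Finset.sum_ite_eq,
    Finset.mem_univ, if_true, ← Finset.sum_smul]
  congr 1
  push_cast
  exact Finset.sum_congr rfl fun i _ => Complex.conj_mul' (l i)

theorem quad_compress {n m : ℕ} (t : Matrix (Fin n) (Fin m) ℂ) (a : Matrix (Fin n) (Fin n) S)
    (l : Fin m → ℂ) : quad (compress t a) l = quad a (t.mulVec l) := by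
  simp only [quad, compress, Matrix.of_apply, Finset.smul_sum, smul_smul, Matrix.mulVec,
    dotProduct, star_sum, Finset.sum_mul_sum, Finset.sum_smul, star_mul']
  calc _ = ∑ i, ∑ k, ∑ j, ∑ q, (star (l i) * l j * (star (t k i) * t q j)) • a k q :=
        Finset.sum_congr rfl fun i _ => Finset.sum_comm
    _ = ∑ k, ∑ i, ∑ j, ∑ q, (star (l i) * l j * (star (t k i) * t q j)) • a k q :=
        Finset.sum_comm
    _ = ∑ k, ∑ i, ∑ q, ∑ j, (star (l i) * l j * (star (t k i) * t q j)) • a k q :=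
        Finset.sum_congr rfl fun k _ => Finset.sum_congr rfl fun i _ => Finset.sum_comm
    _ = ∑ k, ∑ q, ∑ i, ∑ j, (star (l i) * l j * (star (t k i) * t q j)) • a k q :=
        Finset.sum_congr rfl fun k _ => Finset.sum_comm
    _ = _ := by
        refine Finset.sum_congr rfl fun k _ => Finset.sum_congr rfl fun q _ =>
          Finset.sum_congr rfl fun i _ => Finset.sum_congr rfl fun j _ => ?_
        congr 1
        ring

theorem quad_polar {n : ℕ} {a : Matrix (Fin n) (Fin n) S} (h : ∀ l, quad a l = 0) : a = 0 := by
  have key : ∀ (i j : Fin n) (c : ℂ),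
      quad a (Pi.single i 1 + Pi.single j c) =
        a i i + c • a i j + star c • a j i + (star c * c) • a j j := by
    intro i j c
    simp only [quad, Pi.add_apply, star_add, add_mul, mul_add, add_smul, Finset.sum_add_distrib,
      Pi.single_apply, apply_ite star, star_zero, star_one, ite_mul, mul_ite, zero_mul, mul_zero,
      one_mul, mul_one, ite_smul, zero_smul, one_smul, Finset.sum_ite_eq', Finset.mem_univ, if_true]
    simp
    abel
  have diag0 : ∀ i, a i i = 0 := fun i => by
    have := key i i 0
    rw [h] at this
    simpa using this.symm
  ext i j
  have h1 := key i j 1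
  have h2 := key i j Complex.I
  rw [h, diag0, diag0] at h1 h2
  simp only [star_one, one_smul, smul_zero, add_zero, zero_add] at h1
  have e1 : a j i = -a i j := by rw [eq_neg_iff_add_eq_zero, add_comm]; exact h1.symm
  rw [e1] at h2
  have h3 : (2 * Complex.I) • a i j = 0 := by
    rw [h2]; simp [two_mul, add_smul]
  simpa using h3

theorem star_quad [StarAddMonoid S] [StarModule ℂ S] {n : ℕ} (a : Matrix (Fin n) (Fin n) S)
    (l : Fin n → ℂ) : star (quad a l) = quad a.conjTranspose l := by
  simp only [quad, star_sum, star_smul, star_mul', star_star, Matrix.conjTranspose_apply]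
  rw [Finset.sum_comm]
  simp only [mul_comm]

theorem diag_conjTranspose [StarAddMonoid S] (n : ℕ) {s : S} (hs : star s = s) :
    (diag n s).conjTranspose = diag n s := by
  simp [diag, Matrix.diagonal_conjTranspose, Pi.star_def, hs]

theorem compress_conjTranspose [StarAddMonoid S] [StarModule ℂ S] {n m : ℕ}
    (t : Matrix (Fin n) (Fin m) ℂ) (a : Matrix (Fin n) (Fin n) S) :
    (compress t a).conjTranspose = compress t a.conjTranspose := by
  ext i j
  simp only [compress, Matrix.conjTranspose_apply, Matrix.of_apply, star_sum, star_smul, star_mul',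
    star_star]
  rw [Finset.sum_comm]
  simp only [mul_comm]

end MatrixAux

end OperatorSystem

section Structures

open OperatorSystem

/-- An Archimedean order unit space structure on a complex *-vector space: a proper cone of
self-adjoint elements with an Archimedean order unit. -/
structure AOUSpace (S : Type*) [AddCommGroup S] [Module ℂ S] [StarAddMonoid S]
    [StarModule ℂ S] where
  cone : Set S
  unit : S
  star_unit : star unit = unit
  star_eq : ∀ s ∈ cone, star s = s
  zero_mem : (0 : S) ∈ cone
  add_mem : ∀ s ∈ cone, ∀ t ∈ cone, s + t ∈ cone
  smul_mem : ∀ r : ℝ, 0 ≤ r → ∀ s ∈ cone, (r : ℂ) • s ∈ cone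
  proper : ∀ s ∈ cone, -s ∈ cone → s = 0
  orderUnit : ∀ s, star s = s → ∃ r : ℝ, 0 < r ∧ (r : ℂ) • unit + s ∈ cone
  archimedean : ∀ s, star s = s → (∀ r : ℝ, 0 < r → (r : ℂ) • unit + s ∈ cone) → s ∈ cone

/-- An (abstract) operator system structure on a complex *-vector space `S`: a matrix ordering
`(M_n(S)^+)_n` by proper cones, with an Archimedean matrix order unit. -/
structure OperatorSystem (S : Type*) [AddCommGroup S] [Module ℂ S] [StarAddMonoid S]
    [StarModule ℂ S] where
  pos : ∀ n : ℕ, Set (Matrix (Fin n) (Fin n) S)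
  unit : S
  star_unit : star unit = unit
  conjTranspose_eq : ∀ n, ∀ a ∈ pos n, a.conjTranspose = a
  zero_mem : ∀ n, (0 : Matrix (Fin n) (Fin n) S) ∈ pos n
  add_mem : ∀ n, ∀ a ∈ pos n, ∀ b ∈ pos n, a + b ∈ pos n
  smul_mem : ∀ n, ∀ r : ℝ, 0 ≤ r → ∀ a ∈ pos n, (r : ℂ) • a ∈ pos n
  proper : ∀ n, ∀ a ∈ pos n, -a ∈ pos n → a = 0
  compress_mem : ∀ n m, ∀ t : Matrix (Fin n) (Fin m) ℂ, ∀ a ∈ pos n, compress t a ∈ pos m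
  orderUnit : ∀ n, ∀ a : Matrix (Fin n) (Fin n) S, a.conjTranspose = a →
    ∃ r : ℝ, 0 < r ∧ (r : ℂ) • diag n unit + a ∈ pos n
  archimedean : ∀ n, ∀ a : Matrix (Fin n) (Fin n) S, a.conjTranspose = a →
    (∀ r : ℝ, 0 < r → (r : ℂ) • diag n unit + a ∈ pos n) → a ∈ pos n

namespace AOUSpace

variable {S : Type*} [AddCommGroup S] [Module ℂ S] [StarAddMonoid S] [StarModule ℂ S]
  (X : AOUSpace S)

theorem smul_unit_mem {r : ℝ} (hr : 0 ≤ r) : (r : ℂ) • X.unit ∈ X.cone := by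
  obtain ⟨c, hc, h⟩ := X.orderUnit 0 (star_zero S)
  have := X.smul_mem (r / c) (by positivity) _ h
  rwa [add_zero, smul_smul, ← Complex.ofReal_mul, div_mul_cancel₀ _ hc.ne'] at this

theorem sum_mem {ι : Type*} (t : Finset ι) (f : ι → S) (h : ∀ i ∈ t, f i ∈ X.cone) :
    ∑ i ∈ t, f i ∈ X.cone :=
  Finset.sum_induction f (· ∈ X.cone) (fun a b ha hb => X.add_mem a ha b hb) X.zero_mem h

theorem mono {r r' : ℝ} (h : r ≤ r') {s : S} (hs : (r : ℂ) • X.unit + s ∈ X.cone) :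
    (r' : ℂ) • X.unit + s ∈ X.cone := by
  have := X.add_mem _ (X.smul_unit_mem (sub_nonneg.2 h)) _ hs
  rwa [← add_assoc, ← add_smul, ← Complex.ofReal_add, sub_add_cancel] at this

theorem exists_bound_real {s : S} (hs : star s = s) :
    ∃ r : ℝ, 0 ≤ r ∧ ∀ t : ℝ, ((r * |t| : ℝ) : ℂ) • X.unit + (t : ℂ) • s ∈ X.cone := by
  obtain ⟨a, ha, h⟩ := X.orderUnit s hs
  obtain ⟨b, hb, h'⟩ := X.orderUnit (-s) (by rw [star_neg, hs])
  refine ⟨max a b, le_max_of_le_left ha.le, fun t => ?_⟩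
  rcases le_total 0 t with ht | ht
  · have := X.smul_mem t ht _ (X.mono (le_max_left a b) h)
    rw [smul_add, smul_smul, ← Complex.ofReal_mul, mul_comm] at this
    rwa [abs_of_nonneg ht]
  · have := X.smul_mem (-t) (neg_nonneg.2 ht) _ (X.mono (le_max_right a b) h')
    rw [smul_add, smul_smul, ← Complex.ofReal_mul, mul_comm (-t), smul_neg, ← neg_smul,
      ← Complex.ofReal_neg, neg_neg] at this
    rwa [abs_of_nonpos ht]

theorem exists_bound (s : S) :
    ∃ r : ℝ, 0 ≤ r ∧ ∀ z : ℂ, ((r * ‖z‖ : ℝ) : ℂ) • X.unit + (z • s + star (z • s)) ∈ X.cone := by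
  obtain ⟨a, ha, h⟩ := X.exists_bound_real (s := s + star s) (by
    rw [star_add, star_star, add_comm])
  obtain ⟨b, hb, h'⟩ := X.exists_bound_real (s := Complex.I • (s - star s)) (by
    rw [star_smul, star_sub, star_star, Complex.star_def, Complex.conj_I, neg_smul, ← smul_neg,
      neg_sub])
  refine ⟨a + b, add_nonneg ha hb, fun z => ?_⟩
  have h1 := X.mono (mul_le_mul_of_nonneg_left (Complex.abs_re_le_norm z) ha) (h z.re)
  have h2 := X.mono (mul_le_mul_of_nonneg_left (Complex.abs_im_le_norm z) hb) (h' z.im)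
  have h3 := X.add_mem _ h1 _ h2
  convert h3 using 1
  have hz : z = z.re + z.im * Complex.I := (Complex.re_add_im z).symm
  have hz' : star z = z.re - z.im * Complex.I := by
    rw [Complex.star_def]
    apply Complex.ext <;> simp
  rw [star_smul, hz', show z • s = ((z.re : ℂ) + z.im * Complex.I) • s by rw [← hz]]
  push_cast
  module

theorem orderUnit_quad {n : ℕ} (a : Matrix (Fin n) (Fin n) S) (ha : a.conjTranspose = a) :
    ∃ r : ℝ, 0 < r ∧ ∀ l, quad ((r : ℂ) • diag n X.unit + a) l ∈ X.cone := by
  choose r hr h using fun i j => X.exists_bound (a i j)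
  have hR : 0 ≤ ∑ i, ∑ j, r i j := Finset.sum_nonneg fun i _ => Finset.sum_nonneg fun j _ => hr i j
  refine ⟨(∑ i, ∑ j, r i j) / 2 + 1, by positivity, fun l => ?_⟩
  set L : ℝ := ∑ i, ‖l i‖ ^ 2 with hL
  have hL0 : 0 ≤ L := Finset.sum_nonneg fun i _ => by positivity
  have hle : ∀ i j, ‖star (l i) * l j‖ ≤ L := fun i j => by
    have h1 : ‖l i‖ ^ 2 ≤ L :=
      Finset.single_le_sum (f := fun i => ‖l i‖ ^ 2) (fun i _ => by positivity) (Finset.mem_univ i)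
    have h2 : ‖l j‖ ^ 2 ≤ L :=
      Finset.single_le_sum (f := fun i => ‖l i‖ ^ 2) (fun i _ => by positivity) (Finset.mem_univ j)
    rw [norm_mul, norm_star]
    nlinarith [sq_nonneg (‖l i‖ - ‖l j‖)]
  have key := X.sum_mem Finset.univ _ fun i _ => X.sum_mem Finset.univ _ fun j _ =>
    X.mono (mul_le_mul_of_nonneg_left (hle i j) (hr i j)) (h i j (star (l i) * l j))
  simp only [Finset.sum_add_distrib, ← star_sum, ← Finset.sum_smul] at key
  change _ + (quad a l + star (quad a l)) ∈ _ at key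
  rw [star_quad, ha] at key
  have key2 := X.smul_mem (1 / 2) (by norm_num) _ key
  rw [quad_add, quad_smul, quad_diag, smul_smul, ← Complex.ofReal_mul]
  refine X.mono (r := (∑ i, ∑ j, r i j) / 2 * L) (by nlinarith) ?_
  convert key2 using 1
  have e : (∑ i, ∑ j, ((r i j * L : ℝ) : ℂ)) = ((∑ i, ∑ j, (r i j : ℂ)) * L) := by
    push_cast
    simp only [Finset.sum_mul]
  rw [e]
  push_cast
  module

/-- The minimal operator system structure `OMIN(V)` on an Archimedean order unit space `V`:
`a ∈ M_n(V)^+` if and only if `λ* a λ ∈ V^+` for all columns `λ ∈ ℂ^n`. -/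
def OMIN : OperatorSystem S where
  pos n := {a | ∀ l : Fin n → ℂ, quad a l ∈ X.cone}
  unit := X.unit
  star_unit := X.star_unit
  conjTranspose_eq n a ha := by
    rw [← sub_eq_zero]
    refine quad_polar fun l => ?_
    rw [sub_eq_add_neg, quad_add, quad_neg, ← star_quad, X.star_eq _ (ha l), add_neg_cancel]
  zero_mem n l := by
    have : quad (0 : Matrix (Fin n) (Fin n) S) l = 0 := by simp [quad]
    rw [this]
    exact X.zero_mem
  add_mem n a ha b hb l := by
    rw [quad_add]
    exact X.add_mem _ (ha l) _ (hb l)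
  smul_mem n r hr a ha l := by
    rw [quad_smul]
    exact X.smul_mem r hr _ (ha l)
  proper n a ha hb := quad_polar fun l => X.proper _ (ha l) (by
    rw [← quad_neg]
    exact hb l)
  compress_mem n m t a ha l := by
    rw [quad_compress]
    exact ha _
  orderUnit n a ha := X.orderUnit_quad a ha
  archimedean n a ha h l := by
    have hs : star (quad a l) = quad a l := by rw [star_quad, ha]
    refine X.archimedean _ hs fun r hr => ?_
    set L : ℝ := ∑ i, ‖l i‖ ^ 2
    have hL0 : 0 ≤ L := Finset.sum_nonneg fun i _ => by positivity
    have := h (r / (L + 1)) (by positivity) l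
    rw [quad_add, quad_smul, quad_diag, smul_smul, ← Complex.ofReal_mul] at this
    refine X.mono ?_ this
    rw [div_mul_eq_mul_div, div_le_iff₀ (by positivity)]
    nlinarith

end AOUSpace

end Structures

namespace OperatorSystem

variable {S T : Type*} [AddCommGroup S] [Module ℂ S] [StarAddMonoid S] [StarModule ℂ S]
  [AddCommGroup T] [Module ℂ T] [StarAddMonoid T] [StarModule ℂ T]

section Basic

variable (X : OperatorSystem S)

theorem single_star_iff (s : S) : (single s).conjTranspose = single s ↔ star s = s := by
  constructor
  · intro h
    have := congrFun (congrFun h 0) 0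
    simpa [single] using this
  · intro h
    ext i j
    simpa [single] using h

theorem single_diag (s : S) : diag 1 s = single s := by
  ext i j
  simp [diag, single, Subsingleton.elim i j]

/-- The Archimedean order unit space underlying an operator system. -/
def toAOUSpace : AOUSpace S where
  cone := {s | single s ∈ X.pos 1}
  unit := X.unit
  star_unit := X.star_unit
  star_eq s hs := (single_star_iff s).1 (X.conjTranspose_eq 1 _ hs)
  zero_mem := X.zero_mem 1
  add_mem s hs t ht := X.add_mem 1 _ hs _ ht
  smul_mem r hr s hs := X.smul_mem 1 r hr _ hs
  proper s hs ht := by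
    have := X.proper 1 _ hs ht
    exact congrFun (congrFun this 0) 0
  orderUnit s hs := by
    obtain ⟨r, hr, h⟩ := X.orderUnit 1 (single s) ((single_star_iff s).2 hs)
    rw [single_diag] at h
    exact ⟨r, hr, h⟩
  archimedean s hs h := by
    refine X.archimedean 1 (single s) ((single_star_iff s).2 hs) fun r hr => ?_
    rw [single_diag]
    exact h r hr

/-- `OMIN` of (the order unit space underlying) an operator system. -/
def OMIN : OperatorSystem S := X.toAOUSpace.OMIN

/-- States: unital positive linear functionals. -/
def IsState (f : S →ₗ[ℂ] ℂ) : Prop := f X.unit = 1 ∧ ∀ s ∈ X.toAOUSpace.cone, 0 ≤ f s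

theorem smul_diag_mem (n : ℕ) {r : ℝ} (hr : 0 ≤ r) : (r : ℂ) • diag n X.unit ∈ X.pos n := by
  obtain ⟨c, hc, h⟩ := X.orderUnit n 0 (Matrix.conjTranspose_zero)
  have := X.smul_mem n (r / c) (by positivity) _ h
  rwa [add_zero, smul_smul, ← Complex.ofReal_mul, div_mul_cancel₀ _ hc.ne'] at this

end Basic

section Maps

variable (X : OperatorSystem S) (Y : OperatorSystem T)

/-- Completely positive linear maps. -/
def IsCompletelyPositive (φ : S →ₗ[ℂ] T) : Prop :=
  ∀ n, ∀ a ∈ X.pos n, a.map φ ∈ Y.pos n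

/-- Unital complete order isomorphisms. -/
def IsUnitalCompleteOrderIso (φ : S ≃ₗ[ℂ] T) : Prop :=
  φ X.unit = Y.unit ∧ IsCompletelyPositive X Y φ.toLinearMap ∧
    IsCompletelyPositive Y X φ.symm.toLinearMap

/-- Every positive map into the order unit space of `Y` is completely positive into `Y.OMIN`. -/
theorem isCompletelyPositive_OMIN (φ : S →ₗ[ℂ] T)
    (h : ∀ s ∈ X.toAOUSpace.cone, φ s ∈ Y.toAOUSpace.cone) :
    IsCompletelyPositive X Y.OMIN φ := fun n a ha l => by
  rw [quad_map]
  have h1 := X.compress_mem n 1 (Matrix.of fun i (_ : Fin 1) => l i) a ha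
  rw [compress_col] at h1
  exact h _ h1

/-- Equality of two operator systems with generators `a` and `b` indexed by the same set, up to
the canonical unital complete order isomorphism: the one that sends `a x` to `b x` for all `x`. -/
def CanonicallyEq {V : Type*} (a : V → S) (b : V → T) : Prop :=
  ∃ φ : S ≃ₗ[ℂ] T, (∀ x, φ (a x) = b x) ∧ IsUnitalCompleteOrderIso X Y φ

end Maps

section Subsystem

/-- The linear span of a family of self-adjoint elements, a *-vector space. -/
@[nolint unusedArguments]
def SelfAdjSpan {V : Type*} (b : V → S) (_hb : ∀ x, star (b x) = b x) :=
  Submodule.span ℂ (Set.range b)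

namespace SelfAdjSpan

variable {V : Type*} {b : V → S} {hb : ∀ x, star (b x) = b x}

theorem star_mem (hb : ∀ x, star (b x) = b x) {s : S} (hs : s ∈ Submodule.span ℂ (Set.range b)) :
    star s ∈ Submodule.span ℂ (Set.range b) := by
  induction hs using Submodule.span_induction with
  | mem s hs =>
    obtain ⟨x, rfl⟩ := hs
    rw [hb]
    exact Submodule.subset_span ⟨x, rfl⟩
  | zero => rw [star_zero]; exact Submodule.zero_mem _
  | add s t _ _ h h' => rw [star_add]; exact Submodule.add_mem _ h h'
  | smul z s _ h => rw [star_smul]; exact Submodule.smul_mem _ _ h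

instance : AddCommGroup (SelfAdjSpan b hb) :=
  inferInstanceAs (AddCommGroup (Submodule.span ℂ (Set.range b)))
instance : Module ℂ (SelfAdjSpan b hb) :=
  inferInstanceAs (Module ℂ (Submodule.span ℂ (Set.range b)))
instance : StarAddMonoid (SelfAdjSpan b hb) where
  star s := ⟨star s.1, star_mem hb s.2⟩
  star_involutive s := Subtype.ext (star_star s.1)
  star_add s t := Subtype.ext (star_add s.1 t.1)
instance : StarModule ℂ (SelfAdjSpan b hb) where
  star_smul z s := Subtype.ext (star_smul z s.1)

/-- The inclusion of the span. -/
def incl (b : V → S) (hb : ∀ x, star (b x) = b x) : SelfAdjSpan b hb →ₗ[ℂ] S :=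
  (Submodule.span ℂ (Set.range b)).subtype

theorem incl_injective : Function.Injective (incl b hb) := Subtype.val_injective

theorem incl_star (s : SelfAdjSpan b hb) : incl b hb (star s) = star (incl b hb s) := rfl

/-- The generators of the span. -/
def gen (b : V → S) (hb : ∀ x, star (b x) = b x) (x : V) : SelfAdjSpan b hb :=
  ⟨b x, Submodule.subset_span ⟨x, rfl⟩⟩

theorem map_conjTranspose {n : ℕ} (a : Matrix (Fin n) (Fin n) (SelfAdjSpan b hb)) :
    a.conjTranspose.map (incl b hb) = (a.map (incl b hb)).conjTranspose := rfl

theorem map_add' {n : ℕ} (a c : Matrix (Fin n) (Fin n) (SelfAdjSpan b hb)) :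
    (a + c).map (incl b hb) = a.map (incl b hb) + c.map (incl b hb) := rfl

theorem map_smul' {n : ℕ} (z : ℂ) (a : Matrix (Fin n) (Fin n) (SelfAdjSpan b hb)) :
    (z • a).map (incl b hb) = z • a.map (incl b hb) := rfl

theorem map_diag (n : ℕ) (s : SelfAdjSpan b hb) :
    (diag n s).map (incl b hb) = diag n (incl b hb s) :=
  Matrix.diagonal_map (map_zero _)

theorem map_injective {n : ℕ} {a c : Matrix (Fin n) (Fin n) (SelfAdjSpan b hb)}
    (h : a.map (incl b hb) = c.map (incl b hb)) : a = c :=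
  Matrix.map_injective incl_injective h

end SelfAdjSpan

/-- The operator subsystem spanned by a family of self-adjoint elements whose span contains the
unit; its matrix cones are inherited from the ambient operator system. -/
def subsystem (X : OperatorSystem S) {V : Type*} (b : V → S) (hb : ∀ x, star (b x) = b x)
    (h1 : X.unit ∈ Submodule.span ℂ (Set.range b)) : OperatorSystem (SelfAdjSpan b hb) where
  pos n := {a | a.map (SelfAdjSpan.incl b hb) ∈ X.pos n}
  unit := ⟨X.unit, h1⟩
  star_unit := Subtype.ext X.star_unit
  conjTranspose_eq n a ha := SelfAdjSpan.map_injective (X.conjTranspose_eq n _ ha)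
  zero_mem n := by
    have := X.zero_mem n
    rwa [← Matrix.map_zero (SelfAdjSpan.incl b hb) (map_zero _)] at this
  add_mem n a ha c hc := X.add_mem n _ ha _ hc
  smul_mem n r hr a ha := X.smul_mem n r hr _ ha
  proper n a ha hc := SelfAdjSpan.map_injective (by
    rw [Matrix.map_zero _ (map_zero _)]
    exact X.proper n _ ha hc)
  compress_mem n m t a ha := by
    have := X.compress_mem n m t _ ha
    rwa [← compress_map] at this
  orderUnit n a ha := by
    obtain ⟨r, hr, h⟩ := X.orderUnit n (a.map (SelfAdjSpan.incl b hb))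
      (by rw [← SelfAdjSpan.map_conjTranspose, ha])
    refine ⟨r, hr, ?_⟩
    change _ ∈ X.pos n
    rwa [SelfAdjSpan.map_add', SelfAdjSpan.map_smul', SelfAdjSpan.map_diag]
  archimedean n a ha h := by
    refine X.archimedean n _ (by rw [← SelfAdjSpan.map_conjTranspose, ha]) fun r hr => ?_
    have := h r hr
    change _ ∈ X.pos n at this
    rwa [SelfAdjSpan.map_add', SelfAdjSpan.map_smul', SelfAdjSpan.map_diag] at this

end Subsystem

section Quotient

/-- Kernels: intersections of kernels of states. -/
def IsKernel (X : OperatorSystem S) (J : Submodule ℂ S) : Prop :=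
  ∃ F : Set (S →ₗ[ℂ] ℂ), (∀ f ∈ F, X.IsState f) ∧ ∀ u, u ∈ J ↔ ∀ f ∈ F, f u = 0

theorem IsState.map_star {X : OperatorSystem S} {f : S →ₗ[ℂ] ℂ} (hf : X.IsState f) (s : S) :
    f (star s) = star (f s) := by
  have herm : ∀ t : S, star t = t → star (f t) = f t := fun t ht => by
    obtain ⟨r, hr, h⟩ := X.toAOUSpace.orderUnit t ht
    have h1 := hf.2 _ h
    have e : f ((r : ℂ) • X.toAOUSpace.unit + t) = r + f t := by
      rw [map_add, map_smul]
      change (r : ℂ) • f X.unit + _ = _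
      rw [hf.1, smul_eq_mul, mul_one]
    rw [e] at h1
    have h2 := (IsSelfAdjoint.of_nonneg h1).star_eq
    rw [star_add, Complex.star_def, Complex.conj_ofReal] at h2
    exact add_left_cancel h2
  have h1 := herm (s + star s) (by rw [star_add, star_star, add_comm])
  have h2 := herm (Complex.I • (s - star s)) (by
    rw [star_smul, star_sub, star_star, Complex.star_def, Complex.conj_I, neg_smul, ← smul_neg,
      neg_sub])
  rw [map_add, star_add] at h1
  rw [map_smul, map_sub, star_smul, star_sub, Complex.star_def, Complex.conj_I, smul_eq_mul,
    smul_eq_mul, neg_mul, ← mul_neg, neg_sub] at h2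
  have h3 := mul_left_cancel₀ Complex.I_ne_zero h2
  simp only [Complex.star_def] at h1 h3 ⊢
  linear_combination (h3 - h1) / 2

theorem IsKernel.star_mem {X : OperatorSystem S} {J : Submodule ℂ S} (hJ : X.IsKernel J) {u : S}
    (hu : u ∈ J) : star u ∈ J := by
  obtain ⟨F, hF, h⟩ := hJ
  rw [h] at hu ⊢
  intro f hf
  rw [(hF f hf).map_star, hu f hf, star_zero]

/-- The quotient vector space by a kernel. -/
@[nolint unusedArguments]
def Quot (X : OperatorSystem S) (J : Submodule ℂ S) (_hJ : X.IsKernel J) := S ⧸ J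

namespace Quot

variable {X : OperatorSystem S} {J : Submodule ℂ S} {hJ : X.IsKernel J}

instance : AddCommGroup (X.Quot J hJ) := inferInstanceAs (AddCommGroup (S ⧸ J))
instance : Module ℂ (X.Quot J hJ) := inferInstanceAs (Module ℂ (S ⧸ J))

/-- The quotient map. -/
def mk (X : OperatorSystem S) (J : Submodule ℂ S) (hJ : X.IsKernel J) : S →ₗ[ℂ] X.Quot J hJ :=
  J.mkQ

theorem mk_surjective : Function.Surjective (mk X J hJ) := J.mkQ_surjective

theorem mk_eq_zero {u : S} : mk X J hJ u = 0 ↔ u ∈ J := Submodule.Quotient.mk_eq_zero J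

instance : Star (X.Quot J hJ) where
  star := Quotient.map' (s₁ := J.quotientRel) (s₂ := J.quotientRel) star fun s t h => by
    rw [Submodule.quotientRel_def] at h ⊢
    rw [← star_sub]
    exact hJ.star_mem h

theorem mk_star (s : S) : star (mk X J hJ s) = mk X J hJ (star s) := rfl

instance : StarAddMonoid (X.Quot J hJ) where
  star_involutive s := by
    obtain ⟨s, rfl⟩ := mk_surjective s
    rw [mk_star, mk_star, star_star]
  star_add s t := by
    obtain ⟨s, rfl⟩ := mk_surjective s
    obtain ⟨t, rfl⟩ := mk_surjective t
    rw [← map_add, mk_star, mk_star, mk_star, star_add, map_add]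

instance : StarModule ℂ (X.Quot J hJ) where
  star_smul z s := by
    obtain ⟨s, rfl⟩ := mk_surjective s
    rw [← map_smul, mk_star, mk_star, star_smul, map_smul]

theorem map_conjTranspose {n : ℕ} (a : Matrix (Fin n) (Fin n) S) :
    a.conjTranspose.map (mk X J hJ) = (a.map (mk X J hJ)).conjTranspose := rfl

theorem map_diag (n : ℕ) (s : S) : (diag n s).map (mk X J hJ) = diag n (mk X J hJ s) :=
  Matrix.diagonal_map (map_zero _)

theorem exists_map {n : ℕ} (a : Matrix (Fin n) (Fin n) (X.Quot J hJ)) :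
    ∃ b : Matrix (Fin n) (Fin n) S, b.map (mk X J hJ) = a := by
  choose b hb using fun i j => mk_surjective (a i j)
  exact ⟨Matrix.of b, by ext i j; exact hb i j⟩

end Quot

/-- The quotient operator system: `a` is positive in `M_n(S/J)` if and only if `r 1 + a` has a
positive lift in `M_n(S)` for every `r > 0`. -/
def quotient (X : OperatorSystem S) (J : Submodule ℂ S) (hJ : X.IsKernel J) :
    OperatorSystem (X.Quot J hJ) where
  pos n := {a | ∀ r : ℝ, 0 < r → ∃ b ∈ X.pos n,
    b.map (Quot.mk X J hJ) = (r : ℂ) • diag n (Quot.mk X J hJ X.unit) + a}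
  unit := Quot.mk X J hJ X.unit
  star_unit := by rw [Quot.mk_star, X.star_unit]
  conjTranspose_eq n a ha := by
    obtain ⟨b, hb, h⟩ := ha 1 one_pos
    have h' := congrArg Matrix.conjTranspose h
    rw [← Quot.map_conjTranspose, X.conjTranspose_eq n b hb, h, Matrix.conjTranspose_add,
      Matrix.conjTranspose_smul, diag_conjTranspose _ (by rw [Quot.mk_star, X.star_unit]),
      Complex.star_def, Complex.conj_ofReal] at h'
    exact (add_left_cancel h').symm
  zero_mem n r hr := ⟨_, X.smul_diag_mem n hr.le, by
    rw [add_zero, ← Quot.map_diag]; rfl⟩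
  add_mem n a ha b hb r hr := by
    obtain ⟨c, hc, h⟩ := ha (r / 2) (by positivity)
    obtain ⟨d, hd, h'⟩ := hb (r / 2) (by positivity)
    refine ⟨c + d, X.add_mem n c hc d hd, ?_⟩
    rw [Matrix.map_add _ (map_add _), h, h']
    push_cast
    module
  smul_mem n t ht a ha r hr := by
    obtain ⟨c, hc, h⟩ := ha (r / (t + 1)) (by positivity)
    refine ⟨(t : ℂ) • c + ((r / (t + 1) : ℝ) : ℂ) • diag n X.unit,
      X.add_mem n _ (X.smul_mem n t ht c hc) _ (X.smul_diag_mem n (by positivity)), ?_⟩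
    rw [Matrix.map_add _ (map_add _), Matrix.map_smul _ _ (fun _ => map_smul _ _ _),
      Matrix.map_smul _ _ (fun _ => map_smul _ _ _), h, Quot.map_diag]
    have : (r : ℂ) = t * (r / (t + 1) : ℝ) + (r / (t + 1) : ℝ) := by
      rw [← Complex.ofReal_mul, ← Complex.ofReal_add]
      congr 1
      field_simp
    rw [this]
    module
  proper n a ha hna := by
    obtain ⟨c, rfl⟩ := Quot.exists_map a
    refine quad_polar fun l => ?_
    rw [quad_map, Quot.mk_eq_zero]
    obtain ⟨F, hF, hJF⟩ := id hJ
    have step : ∀ f ∈ F, ∀ d : Matrix (Fin n) (Fin n) S,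
        (∀ r : ℝ, 0 < r → ∃ b ∈ X.pos n, b.map (Quot.mk X J hJ) =
          (r : ℂ) • diag n (Quot.mk X J hJ X.unit) + d.map (Quot.mk X J hJ)) →
        0 ≤ f (quad d l) := by
      intro f hf d hd
      set L : ℝ := ∑ i, ‖l i‖ ^ 2
      have hL0 : 0 ≤ L := Finset.sum_nonneg fun i _ => by positivity
      have h1 : ∀ r : ℝ, 0 < r → 0 ≤ (r : ℂ) * L + f (quad d l) := fun r hr => by
        obtain ⟨b, hb, h⟩ := hd r hr
        have h2 := X.compress_mem n 1 (Matrix.of fun i (_ : Fin 1) => l i) b hb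
        rw [compress_col] at h2
        have h3 := (hF f hf).2 _ h2
        have h4 : f (quad b l) = f (quad ((r : ℂ) • diag n X.unit + d) l) := by
          rw [← sub_eq_zero, ← map_sub]
          refine (hJF _).1 ?_ f hf
          rw [← Quot.mk_eq_zero (X := X) (hJ := hJ), map_sub, ← quad_map, ← quad_map, h,
            Matrix.map_add _ (map_add _), Matrix.map_smul _ _ (fun _ => map_smul _ _ _),
            Quot.map_diag, sub_self]
        rw [h4, quad_add, quad_smul, quad_diag, map_add, map_smul, map_smul, (hF f hf).1,
          smul_eq_mul, smul_eq_mul, mul_one] at h3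
        exact h3
      have him : (f (quad d l)).im = 0 := by
        have := (Complex.nonneg_iff.1 (h1 1 one_pos)).2
        simpa using this.symm
      have hre : 0 ≤ (f (quad d l)).re := by
        refine le_of_forall_pos_le_add fun ε hε => ?_
        have := (Complex.nonneg_iff.1 (h1 (ε / (L + 1)) (by positivity))).1
        rw [← Complex.ofReal_mul, Complex.add_re, Complex.ofReal_re] at this
        have h5 : ε / (L + 1) * L ≤ ε := by
          rw [div_mul_eq_mul_div, div_le_iff₀ (by positivity)]
          nlinarith
        linarith
      exact Complex.nonneg_iff.2 ⟨hre, him.symm⟩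
    refine (hJF _).2 fun f hf => ?_
    have h1 := step f hf c ha
    have h2 := step f hf (-c) (by
      have : (-c).map (Quot.mk X J hJ) = -c.map (Quot.mk X J hJ) := by ext i j; simp
      rw [this]
      exact hna)
    rw [quad_neg, map_neg] at h2
    exact le_antisymm (neg_nonneg.1 h2) h1
  compress_mem n m t a ha r hr := by
    obtain ⟨c, hc, h⟩ := X.orderUnit m (-compress t (diag n X.unit)) (by
      rw [Matrix.conjTranspose_neg, compress_conjTranspose, diag_conjTranspose _ X.star_unit])
    obtain ⟨b, hb, hb'⟩ := ha (r / c) (by positivity)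
    refine ⟨((r / c : ℝ) : ℂ) • ((c : ℂ) • diag m X.unit + -compress t (diag n X.unit)) +
      compress t b, X.add_mem m _ (X.smul_mem m _ (by positivity) _ h) _
        (X.compress_mem n m t b hb), ?_⟩
    have hneg : (-compress t (diag n X.unit)).map (Quot.mk X J hJ) =
        -(compress t (diag n X.unit)).map (Quot.mk X J hJ) := by ext i j; simp
    rw [Matrix.map_add _ (map_add _), Matrix.map_smul _ _ (fun _ => map_smul _ _ _),
      Matrix.map_add _ (map_add _), Matrix.map_smul _ _ (fun _ => map_smul _ _ _), hneg,
      compress_map, compress_map, hb', compress_add, compress_smul, Quot.map_diag, Quot.map_diag]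
    have : (r : ℂ) = (r / c : ℝ) * c := by
      rw [← Complex.ofReal_mul, div_mul_cancel₀ _ hc.ne']
    rw [this]
    module
  orderUnit n a ha := by
    obtain ⟨c, rfl⟩ := Quot.exists_map a
    set d : Matrix (Fin n) (Fin n) S := (1 / 2 : ℂ) • (c + c.conjTranspose) with hd
    have hdm : d.map (Quot.mk X J hJ) = c.map (Quot.mk X J hJ) := by
      rw [hd, Matrix.map_smul _ _ (fun _ => map_smul _ _ _), Matrix.map_add _ (map_add _),
        Quot.map_conjTranspose, ha]
      module
    obtain ⟨r, hr, h⟩ := X.orderUnit n d (by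
      rw [hd, Matrix.conjTranspose_smul, Matrix.conjTranspose_add,
        Matrix.conjTranspose_conjTranspose, add_comm]
      simp)
    refine ⟨r, hr, fun e he => ⟨(e : ℂ) • diag n X.unit + ((r : ℂ) • diag n X.unit + d),
      X.add_mem n _ (X.smul_diag_mem n he.le) _ h, ?_⟩⟩
    rw [Matrix.map_add _ (map_add _), Matrix.map_add _ (map_add _),
      Matrix.map_smul _ _ (fun _ => map_smul _ _ _), Matrix.map_smul _ _ (fun _ => map_smul _ _ _),
      hdm, Quot.map_diag]
  archimedean n a ha h r hr := by
    obtain ⟨b, hb, hb'⟩ := h (r / 2) (by positivity) (r / 2) (by positivity)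
    refine ⟨b, hb, ?_⟩
    rw [hb']
    push_cast
    module

end Quotient

section CStarAlgebras

section Aux

variable {B : Type*} [CStarAlgebra B]

theorem cstar_add (x y : B) : ∃ c : B, star x * x + star y * y = star c * c := by
  let _ := CStarAlgebra.spectralOrder B
  have _ := CStarAlgebra.spectralOrderedRing B
  exact CStarAlgebra.nonneg_iff_eq_star_mul_self.1
    (add_nonneg (star_mul_self_nonneg x) (star_mul_self_nonneg y))

theorem cstar_sum {n : ℕ} (x : Fin n → B) : ∃ c : B, ∑ k, star (x k) * x k = star c * c := by
  let _ := CStarAlgebra.spectralOrder B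
  have _ := CStarAlgebra.spectralOrderedRing B
  exact CStarAlgebra.nonneg_iff_eq_star_mul_self.1
    (Finset.sum_nonneg fun k _ => star_mul_self_nonneg (x k))

theorem cstar_proper {a x y : B} (h : a = star x * x) (h' : -a = star y * y) : a = 0 := by
  let _ := CStarAlgebra.spectralOrder B
  have _ := CStarAlgebra.spectralOrderedRing B
  refine le_antisymm (neg_nonneg.1 ?_) ?_
  · rw [h']
    exact star_mul_self_nonneg y
  · rw [h]
    exact star_mul_self_nonneg x

theorem cstar_orderUnit {a : B} (ha : star a = a) :
    ∃ r : ℝ, 0 < r ∧ ∃ c : B, (r : ℂ) • 1 + a = star c * c := by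
  let _ := CStarAlgebra.spectralOrder B
  have _ := CStarAlgebra.spectralOrderedRing B
  have hsa : IsSelfAdjoint a := ha
  refine ⟨‖a‖ + 1, by positivity, CStarAlgebra.nonneg_iff_eq_star_mul_self.1 ?_⟩
  have h1 := hsa.neg_algebraMap_norm_le_self
  rw [neg_le_iff_add_nonneg, Algebra.algebraMap_eq_smul_one] at h1
  have h2 : (0 : B) ≤ 1 := zero_le_one
  have h3 := add_nonneg h2 h1
  convert h3 using 1
  rw [Complex.coe_smul, add_smul, one_smul]
  abel

theorem cstar_archimedean {a : B}
    (h : ∀ r : ℝ, 0 < r → ∃ c : B, (r : ℂ) • 1 + a = star c * c) : ∃ c : B, a = star c * c := by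
  let _ := CStarAlgebra.spectralOrder B
  have _ := CStarAlgebra.spectralOrderedRing B
  refine CStarAlgebra.nonneg_iff_eq_star_mul_self.1 ?_
  have hlim : Filter.Tendsto (fun r : ℝ => (r : ℂ) • (1 : B) + a) (nhdsWithin 0 (Set.Ioi 0))
      (nhds a) := by
    have hc : Continuous fun r : ℝ => (r : ℂ) • (1 : B) + a := by fun_prop
    have := (hc.tendsto 0).mono_left (nhdsWithin_le_nhds (s := Set.Ioi 0))
    simpa using this
  refine CStarAlgebra.isClosed_nonneg.mem_of_tendsto hlim ?_
  filter_upwards [self_mem_nhdsWithin] with r hr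
  obtain ⟨c, hc⟩ := h r hr
  exact hc ▸ star_mul_self_nonneg c

end Aux

variable (A : Type*) [CStarAlgebra A]

/-- A unital C*-algebra `A` as an operator system: the positive elements of the C*-algebra
`M_n(A)` are those of the form `b* b` with `b ∈ M_n(A)`. -/
def ofCStarAlgebra : OperatorSystem A where
  pos n := {a | ∃ b : Matrix (Fin n) (Fin n) A, a = b.conjTranspose * b}
  unit := 1
  star_unit := star_one A
  conjTranspose_eq n a ha := by
    obtain ⟨b, rfl⟩ := ha
    rw [Matrix.conjTranspose_mul, Matrix.conjTranspose_conjTranspose]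
  zero_mem n := ⟨0, by simp⟩
  add_mem n a ha b hb := by
    let _ := CStarAlgebra.spectralOrder A
    have _ := CStarAlgebra.spectralOrderedRing A
    obtain ⟨x, rfl⟩ := ha
    obtain ⟨y, rfl⟩ := hb
    exact @cstar_add (CStarMatrix (Fin n) (Fin n) A) CStarMatrix.instCStarAlgebra x y
  smul_mem n r hr a ha := by
    obtain ⟨b, rfl⟩ := ha
    refine ⟨((√r : ℝ) : ℂ) • b, ?_⟩
    rw [Matrix.conjTranspose_smul, Matrix.smul_mul, Matrix.mul_smul, smul_smul, Complex.star_def,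
      Complex.conj_ofReal, ← Complex.ofReal_mul, Real.mul_self_sqrt hr]
  proper n a ha hb := by
    let _ := CStarAlgebra.spectralOrder A
    have _ := CStarAlgebra.spectralOrderedRing A
    obtain ⟨x, hx⟩ := ha
    obtain ⟨y, hy⟩ := hb
    exact @cstar_proper (CStarMatrix (Fin n) (Fin n) A) CStarMatrix.instCStarAlgebra a x y hx hy
  compress_mem n m t a ha := by
    let _ := CStarAlgebra.spectralOrder A
    have _ := CStarAlgebra.spectralOrderedRing A
    obtain ⟨b, rfl⟩ := ha
    rcases m with _ | m
    · exact ⟨0, Subsingleton.elim _ _⟩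
    set c : Matrix (Fin n) (Fin (m + 1)) A := Matrix.of fun k j => ∑ l, t l j • b k l with hc
    let row : Fin n → Matrix (Fin (m + 1)) (Fin (m + 1)) A := fun k =>
      Matrix.of fun i j => if i = 0 then c k j else 0
    have key : compress t (b.conjTranspose * b) = ∑ k, (row k).conjTranspose * row k := by
      ext i j
      have hr : ∀ k, ((row k).conjTranspose * row k) i j = star (c k i) * c k j := by
        intro k
        rw [Matrix.mul_apply, Finset.sum_eq_single 0]
        · simp [row]
        · intro q _ hq
          simp [row, hq]
        · simp
      rw [Matrix.sum_apply]
      simp only [hr, hc, compress, Matrix.of_apply, Matrix.mul_apply, Matrix.conjTranspose_apply,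
        Finset.smul_sum, star_sum, star_smul, Finset.sum_mul_sum, smul_mul_smul_comm]
      calc _ = ∑ p, ∑ k, ∑ q, (star (t p i) * t q j) • (star (b k p) * b k q) :=
            Finset.sum_congr rfl fun p _ => Finset.sum_comm
        _ = _ := Finset.sum_comm
    rw [key]
    exact @cstar_sum (CStarMatrix (Fin (m + 1)) (Fin (m + 1)) A) CStarMatrix.instCStarAlgebra n _
  orderUnit n a ha := by
    let _ := CStarAlgebra.spectralOrder A
    have _ := CStarAlgebra.spectralOrderedRing A
    exact @cstar_orderUnit (CStarMatrix (Fin n) (Fin n) A) CStarMatrix.instCStarAlgebra a ha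
  archimedean n a ha h := by
    let _ := CStarAlgebra.spectralOrder A
    have _ := CStarAlgebra.spectralOrderedRing A
    exact @cstar_archimedean (CStarMatrix (Fin n) (Fin n) A) CStarMatrix.instCStarAlgebra a h

end CStarAlgebras

end OperatorSystem

/-- A contextuality scenario on a finite vertex set `V`: a hypergraph with a non-empty set of
hyperedges that covers `V`. -/
structure ContextualityScenario (V : Type u) where
  edges : Finset (Finset V)
  edges_nonempty : edges.Nonempty
  cover : ∀ x : V, ∃ e ∈ edges, x ∈ e

namespace ContextualityScenario

variable {V : Type u} (G : ContextualityScenario V)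

/-- Probabilistic models of `G`. -/
def models : Set (V → ℝ) :=
  {p | (∀ x, p x ∈ Set.Icc (0 : ℝ) 1) ∧ ∀ e ∈ G.edges, ∑ x ∈ e, p x = 1}

/-- Deterministic models of `G`. -/
def deterministicModels : Set (V → ℝ) :=
  {p | p ∈ G.models ∧ ∀ x, p x = 0 ∨ p x = 1}

/-- Classical models of `G`: convex combinations of deterministic ones. -/
def classicalModels : Set (V → ℝ) := convexHull ℝ G.deterministicModels

/-- A projective representation of `G` on a Hilbert space. -/
structure ProjRep where
  H : Type u
  [normed : NormedAddCommGroup H]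
  [inner : InnerProductSpace ℂ H]
  [complete : CompleteSpace H]
  P : V → (H →L[ℂ] H)
  proj : ∀ x, IsStarProjection (P x)
  sum_eq : ∀ e ∈ G.edges, ∑ x ∈ e, P x = 1

attribute [instance] ProjRep.normed ProjRep.inner ProjRep.complete

/-- Quantum models of `G`. -/
def quantumModels : Set (V → ℝ) :=
  {p | ∃ (R : G.ProjRep) (ψ : R.H), ‖ψ‖ = 1 ∧ ∀ x, (p x : ℂ) = inner ℂ ψ (R.P x ψ)}

/-! ### The hypergraph C*-algebra -/

/-- The conjugate-linear map on the free algebra that reverses words and conjugates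
coefficients. -/
noncomputable def conjReverse (V : Type u) :
    MonoidAlgebra ℂ (FreeMonoid V) →+ MonoidAlgebra ℂ (FreeMonoid V) where
  toFun a := MonoidAlgebra.ofCoeff ((a.coeff.mapDomain star).mapRange (starRingEnd ℂ) (map_zero _))
  map_zero' := congrArg MonoidAlgebra.ofCoeff
    (by rw [MonoidAlgebra.coeff_zero, Finsupp.mapDomain_zero, Finsupp.mapRange_zero])
  map_add' a b := congrArg MonoidAlgebra.ofCoeff (by
    rw [MonoidAlgebra.coeff_add, Finsupp.mapDomain_add, Finsupp.mapRange_add (map_add _)]; rfl)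

theorem conjReverse_single (w : FreeMonoid V) (c : ℂ) :
    conjReverse V (MonoidAlgebra.single w c) = MonoidAlgebra.single (star w) (star c) := by
  refine congrArg MonoidAlgebra.ofCoeff ?_
  rw [MonoidAlgebra.coeff_single, Finsupp.mapDomain_single, Finsupp.mapRange_single]
  rfl

/-- The free unital complex *-algebra on self-adjoint generators indexed by `V`: linear
combinations of words in `V`. The scenario is recorded in the type since it determines the
seminorm below. -/
@[nolint unusedArguments]
def FreeStarAlg (_G : ContextualityScenario V) : Type u := MonoidAlgebra ℂ (FreeMonoid V)

noncomputable instance : Ring G.FreeStarAlg := inferInstanceAs (Ring (MonoidAlgebra ℂ (FreeMonoid V)))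
noncomputable instance : Algebra ℂ G.FreeStarAlg :=
  inferInstanceAs (Algebra ℂ (MonoidAlgebra ℂ (FreeMonoid V)))

namespace FreeStarAlg

/-- The word `w` with coefficient `c`. -/
noncomputable def word (w : FreeMonoid V) (c : ℂ) : G.FreeStarAlg := MonoidAlgebra.single w c

variable {G}

theorem word_mul (w w' : FreeMonoid V) (c c' : ℂ) :
    word G w c * word G w' c' = word G (w * w') (c * c') :=
  MonoidAlgebra.single_mul_single ..

theorem one_eq : (1 : G.FreeStarAlg) = word G 1 1 := rfl

theorem smul_word (z : ℂ) (w : FreeMonoid V) (c : ℂ) : z • word G w c = word G w (z * c) :=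
  MonoidAlgebra.smul_single' ..

theorem induction {motive : G.FreeStarAlg → Prop} (a : G.FreeStarAlg) (zero : motive 0)
    (add : ∀ a b, motive a → motive b → motive (a + b)) (wd : ∀ w c, motive (word G w c)) :
    motive a :=
  MonoidAlgebra.induction_linear (motive := motive) a zero add wd

/-- The involution on `G.FreeStarAlg`. -/
noncomputable def starHom : G.FreeStarAlg →+ G.FreeStarAlg := conjReverse V

theorem starHom_word (w : FreeMonoid V) (c : ℂ) :
    starHom (word G w c) = word G (star w) (star c) :=
  conjReverse_single w c

noncomputable instance : StarRing G.FreeStarAlg where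
  star := starHom
  star_involutive a := by
    induction a using FreeStarAlg.induction with
    | zero => simp
    | add a b ha hb => rw [map_add, map_add, ha, hb]
    | wd w c => rw [starHom_word, starHom_word, star_star, star_star]
  star_mul a b := by
    induction a using FreeStarAlg.induction with
    | zero => simp
    | add a a' ha ha' => rw [add_mul, map_add, map_add, ha, ha', mul_add]
    | wd w c =>
      induction b using FreeStarAlg.induction with
      | zero => simp
      | add a a' ha ha' => rw [mul_add, map_add, map_add, ha, ha', add_mul]
      | wd w' c' =>
        simp only [word_mul, starHom_word, star_mul]
  star_add := map_add starHom

theorem star_word (w : FreeMonoid V) (c : ℂ) :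
    star (word G w c) = word G (star w) (star c) := starHom_word w c

instance : StarModule ℂ G.FreeStarAlg where
  star_smul z a := by
    induction a using FreeStarAlg.induction with
    | zero => simp
    | add a b ha hb => rw [smul_add, star_add, star_add, smul_add, ha, hb]
    | wd w c => rw [smul_word, star_word, star_word, smul_word, star_mul']

/-- The generator attached to the vertex `x`. -/
noncomputable def gen (x : V) : G.FreeStarAlg := word G (FreeMonoid.of x) 1

theorem star_gen (x : V) : star (gen x : G.FreeStarAlg) = gen x := by
  rw [gen, star_word, FreeMonoid.star_of, star_one]

/-- The evaluation of *-polynomials at a projective representation. -/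
noncomputable def eval (R : G.ProjRep) : G.FreeStarAlg →ₐ[ℂ] (R.H →L[ℂ] R.H) :=
  MonoidAlgebra.lift ℂ (R.H →L[ℂ] R.H) (FreeMonoid V) (FreeMonoid.lift R.P)

theorem eval_word (R : G.ProjRep) (w : FreeMonoid V) (c : ℂ) :
    eval R (word G w c) = c • FreeMonoid.lift R.P w := MonoidAlgebra.lift_single ..

theorem eval_gen (R : G.ProjRep) (x : V) : eval R (gen x) = R.P x := by
  rw [gen, eval_word, FreeMonoid.lift_eval_of, one_smul]

theorem lift_star (R : G.ProjRep) (w : FreeMonoid V) :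
    FreeMonoid.lift R.P (star w) = star (FreeMonoid.lift R.P w) := by
  induction w using FreeMonoid.inductionOn' with
  | one => simp
  | of_mul x w ih =>
    rw [star_mul, map_mul, ih, FreeMonoid.star_of, map_mul, star_mul, FreeMonoid.lift_eval_of,
      (R.proj x).isSelfAdjoint.star_eq]

theorem eval_star (R : G.ProjRep) (a : G.FreeStarAlg) : eval R (star a) = star (eval R a) := by
  induction a using FreeStarAlg.induction with
  | zero => simp
  | add a b ha hb => simp only [star_add, map_add, ha, hb]
  | wd w c => rw [star_word, eval_word, eval_word, star_smul, lift_star]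

theorem norm_lift_le (R : G.ProjRep) (w : FreeMonoid V) : ‖FreeMonoid.lift R.P w‖ ≤ 1 := by
  induction w using FreeMonoid.inductionOn' with
  | one =>
    rw [map_one]
    exact ContinuousLinearMap.norm_id_le
  | of_mul x w ih =>
    rw [map_mul, FreeMonoid.lift_eval_of]
    exact (norm_mul_le _ _).trans (mul_le_one₀ ((R.proj x).norm_le) (norm_nonneg _) ih)

theorem exists_bound (a : G.FreeStarAlg) : ∃ C : ℝ, ∀ R : G.ProjRep, ‖eval R a‖ ≤ C := by
  induction a using FreeStarAlg.induction with
  | zero => exact ⟨0, fun R => by simp⟩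
  | add a b ha hb =>
    obtain ⟨C, hC⟩ := ha
    obtain ⟨D, hD⟩ := hb
    exact ⟨C + D, fun R => by
      rw [map_add]; exact (norm_add_le _ _).trans (add_le_add (hC R) (hD R))⟩
  | wd w c =>
    refine ⟨‖c‖, fun R => ?_⟩
    rw [eval_word, norm_smul]
    exact mul_le_of_le_one_right (norm_nonneg _) (norm_lift_le R w)

/-- The universal C*-seminorm: the supremum over all projective representations. -/
noncomputable def univNorm (a : G.FreeStarAlg) : ℝ := ⨆ R : G.ProjRep, ‖eval R a‖

theorem le_univNorm (R : G.ProjRep) (a : G.FreeStarAlg) : ‖eval R a‖ ≤ univNorm a := by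
  obtain ⟨C, hC⟩ := exists_bound a
  exact le_ciSup (f := fun R : G.ProjRep => ‖eval R a‖) ⟨C, by rintro _ ⟨R, rfl⟩; exact hC R⟩ R

theorem univNorm_le {a : G.FreeStarAlg} {C : ℝ} (h0 : 0 ≤ C)
    (h : ∀ R : G.ProjRep, ‖eval R a‖ ≤ C) : univNorm a ≤ C := Real.iSup_le h h0

theorem univNorm_nonneg (a : G.FreeStarAlg) : 0 ≤ univNorm a :=
  Real.iSup_nonneg fun _ => norm_nonneg _

theorem univNorm_mul (a b : G.FreeStarAlg) : univNorm (a * b) ≤ univNorm a * univNorm b := by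
  refine univNorm_le (mul_nonneg (univNorm_nonneg a) (univNorm_nonneg b)) fun R => ?_
  rw [map_mul]
  exact (norm_mul_le _ _).trans
    (mul_le_mul (le_univNorm R a) (le_univNorm R b) (norm_nonneg _) (univNorm_nonneg a))

/-- `univNorm` as a seminorm of additive groups. -/
noncomputable def univSeminorm : AddGroupSeminorm G.FreeStarAlg where
  toFun := univNorm
  map_zero' := le_antisymm (univNorm_le le_rfl fun R => by simp) (univNorm_nonneg 0)
  add_le' a b := by
    refine univNorm_le (add_nonneg (univNorm_nonneg a) (univNorm_nonneg b)) fun R => ?_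
    rw [map_add]
    exact (norm_add_le _ _).trans (add_le_add (le_univNorm R a) (le_univNorm R b))
  neg' a := by simp only [univNorm, map_neg, norm_neg]

noncomputable instance : SeminormedRing G.FreeStarAlg where
  __ := (inferInstance : Ring G.FreeStarAlg)
  __ := (univSeminorm (G := G)).toSeminormedAddCommGroup
  norm_mul_le := univNorm_mul

theorem norm_def (a : G.FreeStarAlg) : ‖a‖ = univNorm a := rfl

noncomputable instance : NormedAlgebra ℂ G.FreeStarAlg where
  norm_smul_le z a := by
    refine univNorm_le (mul_nonneg (norm_nonneg z) (univNorm_nonneg a)) fun R => ?_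
    rw [map_smul, norm_smul]
    exact mul_le_mul_of_nonneg_left (le_univNorm R a) (norm_nonneg z)

theorem norm_star (a : G.FreeStarAlg) : ‖star a‖ = ‖a‖ := by
  simp only [norm_def, univNorm, eval_star, _root_.norm_star]

theorem norm_mul_self_le (a : G.FreeStarAlg) : ‖a‖ * ‖a‖ ≤ ‖star a * a‖ := by
  have h : ‖a‖ ≤ √‖star a * a‖ := by
    refine univNorm_le (Real.sqrt_nonneg _) fun R => Real.le_sqrt_of_sq_le ?_
    have := le_univNorm R (star a * a)
    rwa [map_mul, eval_star, CStarRing.norm_star_mul_self, ← sq] at this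
  calc ‖a‖ * ‖a‖ ≤ √‖star a * a‖ * √‖star a * a‖ := 
        mul_le_mul h h (norm_nonneg _) (Real.sqrt_nonneg _)
    _ = ‖star a * a‖ := Real.mul_self_sqrt (norm_nonneg _)

theorem isometry_star : Isometry (star : G.FreeStarAlg → G.FreeStarAlg) :=
  AddMonoidHomClass.isometry_of_norm (starHom (G := G)) norm_star

end FreeStarAlg

/-- The hypergraph C*-algebra `C*(G)`: the universal C*-algebra generated by projections `p_x`
with `∑ x ∈ e, p_x = 1` for all hyperedges `e`, realised as the Hausdorff completion of the free
*-algebra in the supremum of the seminorms given by the projective representations of `G`. -/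
def CStar : Type u := UniformSpace.Completion G.FreeStarAlg

namespace CStar

noncomputable instance : NormedRing G.CStar :=
  inferInstanceAs (NormedRing (UniformSpace.Completion G.FreeStarAlg))
instance : CompleteSpace G.CStar :=
  inferInstanceAs (CompleteSpace (UniformSpace.Completion G.FreeStarAlg))
noncomputable instance : Algebra ℂ G.CStar :=
  inferInstanceAs (Algebra ℂ (UniformSpace.Completion G.FreeStarAlg))
noncomputable instance : NormedAlgebra ℂ G.CStar where
  norm_smul_le := (inferInstance : NormedSpace ℂ (UniformSpace.Completion G.FreeStarAlg)).norm_smul_le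

variable {G}

/-- The canonical map from the free *-algebra. -/
noncomputable def ofFree : G.FreeStarAlg →ₐ[ℂ] G.CStar where
  __ := (UniformSpace.Completion.coeRingHom : G.FreeStarAlg →+* UniformSpace.Completion G.FreeStarAlg)
  commutes' _ := rfl

theorem norm_ofFree (a : G.FreeStarAlg) : ‖ofFree a‖ = ‖a‖ := UniformSpace.Completion.norm_coe a

theorem isometry_ofFree : Isometry (ofFree (G := G)) :=
  AddMonoidHomClass.isometry_of_norm _ norm_ofFree

theorem denseRange_ofFree : DenseRange (ofFree (G := G)) := UniformSpace.Completion.denseRange_coe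

noncomputable instance : Star G.CStar :=
  ⟨UniformSpace.Completion.map (star : G.FreeStarAlg → G.FreeStarAlg)⟩

theorem star_ofFree (a : G.FreeStarAlg) : star (ofFree a) = ofFree (star a) :=
  UniformSpace.Completion.map_coe FreeStarAlg.isometry_star.uniformContinuous a

theorem continuous_star' : Continuous (star : G.CStar → G.CStar) :=
  UniformSpace.Completion.continuous_map

noncomputable instance : StarRing G.CStar where
  star_involutive a := by
    refine denseRange_ofFree.induction_on (p := fun a : G.CStar => star (star a) = a) a
      (isClosed_eq (continuous_star'.comp continuous_star') continuous_id) fun a => ?_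
    rw [star_ofFree, star_ofFree, star_star]
  star_mul a b := by
    refine denseRange_ofFree.induction_on₂ (p := fun a b : G.CStar => star (a * b) = star b * star a)
      (isClosed_eq (continuous_star'.comp continuous_mul)
        ((continuous_star'.comp continuous_snd).mul (continuous_star'.comp continuous_fst)))
      (fun a b => ?_) a b
    rw [← map_mul, star_ofFree, star_ofFree, star_ofFree, star_mul, map_mul]
  star_add a b := by
    refine denseRange_ofFree.induction_on₂ (p := fun a b : G.CStar => star (a + b) = star a + star b)
      (isClosed_eq (continuous_star'.comp continuous_add)
        ((continuous_star'.comp continuous_fst).add (continuous_star'.comp continuous_snd)))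
      (fun a b => ?_) a b
    rw [← map_add, star_ofFree, star_ofFree, star_ofFree, star_add, map_add]

noncomputable instance : CStarAlgebra G.CStar where
  norm_mul_self_le a := by
    refine denseRange_ofFree.induction_on (p := fun a : G.CStar => ‖a‖ * ‖a‖ ≤ ‖star a * a‖) a
      (isClosed_le (continuous_norm.mul continuous_norm)
        (continuous_norm.comp (continuous_star'.mul continuous_id))) fun a => ?_
    rw [star_ofFree, ← map_mul, norm_ofFree, norm_ofFree]
    exact FreeStarAlg.norm_mul_self_le a
  star_smul z a := by
    refine denseRange_ofFree.induction_on (p := fun a : G.CStar => star (z • a) = star z • star a) a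
      (isClosed_eq (continuous_star'.comp (continuous_const_smul z))
        (continuous_star'.const_smul (star z))) fun a => ?_
    rw [← map_smul, star_ofFree, star_ofFree, star_smul, map_smul]

/-- The canonical projections `p_x`. -/
noncomputable def p (x : V) : G.CStar := ofFree (FreeStarAlg.gen x)

theorem ofFree_eq_of_eval {a b : G.FreeStarAlg}
    (h : ∀ R : G.ProjRep, FreeStarAlg.eval R a = FreeStarAlg.eval R b) : ofFree a = ofFree b := by
  rw [← sub_eq_zero, ← map_sub, ← norm_eq_zero, norm_ofFree]
  refine le_antisymm (FreeStarAlg.univNorm_le le_rfl fun R => ?_) (norm_nonneg _)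
  rw [map_sub, h R, sub_self, norm_zero]

theorem isStarProjection_p (x : V) : IsStarProjection (p x : G.CStar) where
  isIdempotentElem := by
    rw [IsIdempotentElem, p, ← map_mul]
    refine ofFree_eq_of_eval fun R => ?_
    rw [map_mul, FreeStarAlg.eval_gen]
    exact (R.proj x).isIdempotentElem
  isSelfAdjoint := by
    rw [IsSelfAdjoint, p, star_ofFree, FreeStarAlg.star_gen]

theorem sum_p {e : Finset V} (he : e ∈ G.edges) : ∑ x ∈ e, (p x : G.CStar) = 1 := by
  simp only [p]
  rw [← map_sum, ← map_one ofFree]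
  refine ofFree_eq_of_eval fun R => ?_
  simp only [map_sum, FreeStarAlg.eval_gen, map_one]
  exact R.sum_eq e he

end CStar

end ContextualityScenario

/-! ### The operator systems of a contextuality scenario -/

namespace ContextualityScenario

variable {V : Type u} (G : ContextualityScenario V)

/-- The hyperedges of `G`. -/
abbrev Edge : Type u := {e : Finset V // e ∈ G.edges}

/-- The vertices of a hyperedge. -/
abbrev Edge.Vertex {G : ContextualityScenario V} (e : G.Edge) : Type u := {x : V // x ∈ e.1}

instance : Nonempty G.Edge := G.edges_nonempty.to_subtype

/-- A hyperedge containing `x`. -/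
noncomputable def edgeOf (x : V) : G.Edge := ⟨(G.cover x).choose, (G.cover x).choose_spec.1⟩

theorem mem_edgeOf (x : V) : x ∈ (G.edgeOf x).1 := (G.cover x).choose_spec.2

/-! #### The universal operator system of general models -/

/-- The C*-algebra `⊕_{e ∈ E} ℓ^∞_e`. -/
abbrev EdgeSum : Type u := ∀ e : G.Edge, e.Vertex → ℂ

/-- The element `δ_x^e` of the summand `ℓ^∞_e`, in `⊕_{e ∈ E} ℓ^∞_e`. -/
noncomputable def delta (e : G.Edge) (x : e.Vertex) : G.EdgeSum := by
  classical exact Pi.single e (Pi.single x 1)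

/-- The pairing `⟨p, u⟩ = ∑_{e ∈ E} ∑_{x ∈ e} p(x) u_x^e`. -/
noncomputable def pairing (p : V → ℝ) : G.EdgeSum →ₗ[ℂ] ℂ where
  toFun u := ∑ e : G.Edge, ∑ x : e.Vertex, (p x.1 : ℂ) * u e x
  map_add' u v := by simp [mul_add, Finset.sum_add_distrib]
  map_smul' z u := by simp [Finset.mul_sum, mul_left_comm]

theorem pairing_delta (p : V → ℝ) (e : G.Edge) (x : e.Vertex) :
    G.pairing p (G.delta e x) = p x.1 := by
  classical
  change ∑ f : G.Edge, ∑ y : f.Vertex, (p y.1 : ℂ) * G.delta e x f y = p x.1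
  rw [Finset.sum_eq_single e, Finset.sum_eq_single x]
  · simp [delta]
  · intro y _ hy
    simp [delta, hy]
  · simp
  · intro f _ hf
    simp [delta, hf]
  · simp

theorem pairing_one {p : V → ℝ} (hp : p ∈ G.models) : G.pairing p 1 = (G.edges.card : ℂ) := by
  have h : ∀ e : G.Edge, ∑ x : e.Vertex, (p x.1 : ℂ) = 1 := fun e => by
    have := hp.2 e.1 e.2
    rw [← Finset.sum_coe_sort] at this
    rw [← Complex.ofReal_sum, this, Complex.ofReal_one]
  change ∑ e : G.Edge, ∑ x : e.Vertex, (p x.1 : ℂ) * 1 = _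
  simp only [mul_one, h]
  simp

/-- The subspace of all `u` with `⟨p, u⟩ = 0` for every probabilistic model `p`. -/
noncomputable def nullSpace : Submodule ℂ G.EdgeSum :=
  ⨅ p ∈ G.models, LinearMap.ker (G.pairing p)

theorem mem_nullSpace {u : G.EdgeSum} :
    u ∈ G.nullSpace ↔ ∀ p ∈ G.models, G.pairing p u = 0 := by
  simp [nullSpace, Submodule.mem_iInf]

theorem isKernel_nullSpace :
    (OperatorSystem.ofCStarAlgebra G.EdgeSum).IsKernel G.nullSpace := by
  have hd : (G.edges.card : ℂ) ≠ 0 := by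
    simpa using G.edges_nonempty.ne_empty
  refine ⟨{f | ∃ p ∈ G.models, f = (G.edges.card : ℂ)⁻¹ • G.pairing p}, ?_, fun u => ?_⟩
  · rintro f ⟨p, hp, rfl⟩
    refine ⟨?_, fun s hs => ?_⟩
    · change (G.edges.card : ℂ)⁻¹ * G.pairing p 1 = 1
      rw [G.pairing_one hp, inv_mul_cancel₀ hd]
    · obtain ⟨b, hb⟩ := hs
      have hs' : s = star (b 0 0) * b 0 0 := by
        have := congrFun (congrFun hb 0) 0
        rw [Matrix.mul_apply] at this
        simpa [OperatorSystem.single] using this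
      change 0 ≤ (G.edges.card : ℂ)⁻¹ * ∑ e : G.Edge, ∑ x : e.Vertex, (p x.1 : ℂ) * s e x
      refine mul_nonneg (by rw [inv_nonneg]; exact Nat.cast_nonneg _) (Finset.sum_nonneg fun e _ =>
        Finset.sum_nonneg fun x _ => mul_nonneg (Complex.zero_le_real.2 (hp.1 x.1).1) ?_)
      rw [hs']
      exact star_mul_self_nonneg (b 0 0 e x)
  · rw [mem_nullSpace]
    constructor
    · rintro h f ⟨p, hp, rfl⟩
      rw [LinearMap.smul_apply, h p hp, smul_zero]
    · intro h p hp
      have := h _ ⟨p, hp, rfl⟩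
      rw [LinearMap.smul_apply, smul_eq_mul] at this
      exact (mul_eq_zero.1 this).resolve_left (inv_ne_zero hd)

/-- The underlying vector space of the operator system `S_G`. -/
abbrev SSpace : Type u :=
  OperatorSystem.Quot (OperatorSystem.ofCStarAlgebra G.EdgeSum) G.nullSpace G.isKernel_nullSpace

/-- The operator system `S_G`, universal for positive operator representations of `G`. -/
noncomputable def S : OperatorSystem G.SSpace :=
  (OperatorSystem.ofCStarAlgebra G.EdgeSum).quotient G.nullSpace G.isKernel_nullSpace

/-- The canonical generators `a_x = |E| [δ_x^e]` of `S_G`. -/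
noncomputable def a (x : V) : G.SSpace :=
  (G.edges.card : ℂ) • OperatorSystem.Quot.mk (OperatorSystem.ofCStarAlgebra G.EdgeSum)
    G.nullSpace G.isKernel_nullSpace (G.delta (G.edgeOf x) ⟨x, G.mem_edgeOf x⟩)

/-- The generator `a_x` does not depend on the choice of a hyperedge containing `x`. -/
theorem a_eq (e : G.Edge) (x : e.Vertex) :
    G.a x.1 = (G.edges.card : ℂ) • OperatorSystem.Quot.mk (OperatorSystem.ofCStarAlgebra G.EdgeSum)
      G.nullSpace G.isKernel_nullSpace (G.delta e x) := by
  rw [a, ← sub_eq_zero, ← smul_sub, ← map_sub,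
    OperatorSystem.Quot.mk_eq_zero.2, smul_zero]
  rw [mem_nullSpace]
  intro p _
  rw [map_sub, pairing_delta, pairing_delta, sub_self]

/-! #### The operator system of quantum models -/

theorem star_p (x : V) : star (CStar.p x : G.CStar) = CStar.p x :=
  (CStar.isStarProjection_p x).isSelfAdjoint

theorem one_mem_span_p : (OperatorSystem.ofCStarAlgebra G.CStar).unit ∈
    Submodule.span ℂ (Set.range (CStar.p : V → G.CStar)) := by
  obtain ⟨e, he⟩ := G.edges_nonempty
  change (1 : G.CStar) ∈ _
  rw [← CStar.sum_p he]
  exact Submodule.sum_mem _ fun x _ => Submodule.subset_span ⟨x, rfl⟩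

/-- The underlying vector space of the operator system `T_G`. -/
abbrev TSpace : Type u := OperatorSystem.SelfAdjSpan (CStar.p : V → G.CStar) G.star_p

/-- The operator system `T_G = span {p_x : x ∈ V}`, an operator subsystem of `C*(G)`. -/
noncomputable def T : OperatorSystem G.TSpace :=
  (OperatorSystem.ofCStarAlgebra G.CStar).subsystem CStar.p G.star_p G.one_mem_span_p

/-- The canonical generators `p_x` of `T_G`. -/
noncomputable def p (x : V) : G.TSpace := OperatorSystem.SelfAdjSpan.gen CStar.p G.star_p x

/-! #### The operator system of classical models -/

/-- Points of the product `∏_{e ∈ E} e`. -/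
abbrev Selection : Type u := ∀ e : G.Edge, e.Vertex

/-- The C*-algebra `⊗_{e ∈ E} ℓ^∞_e = C(∏_{e ∈ E} e)`. -/
abbrev EdgeTensor : Type u := G.Selection → ℂ

/-- The elementary tensor with `δ_x^e` in the factor `ℓ^∞_e` and `1` elsewhere, as a function on
`∏_{e ∈ E} e`. -/
noncomputable def tensorDelta (e : G.Edge) (x : e.Vertex) : G.EdgeTensor := fun ω => by
  classical exact if ω e = x then 1 else 0

/-- The ideal of `⊗_{e ∈ E} ℓ^∞_e` that identifies `δ_x^e` with `δ_x^f` for `x ∈ e ∩ f`. -/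
def tensorIdeal : Ideal G.EdgeTensor :=
  Ideal.span {g | ∃ (e f : G.Edge) (x : V) (he : x ∈ e.1) (hf : x ∈ f.1),
    g = G.tensorDelta e ⟨x, he⟩ - G.tensorDelta f ⟨x, hf⟩}

/-- The points of `∏_{e ∈ E} e` at which all elements of `tensorIdeal` vanish. -/
def zeroLocus : Set G.Selection := {ω | ∀ g ∈ G.tensorIdeal, g ω = 0}

theorem mem_tensorIdeal (g : G.EdgeTensor) :
    g ∈ G.tensorIdeal ↔ ∀ ω ∈ G.zeroLocus, g ω = 0 := by
  classical
  refine ⟨fun hg ω hω => hω g hg, fun h => ?_⟩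
  have : Finite G.Selection := inferInstance
  have := Fintype.ofFinite G.Selection
  have hsum : g = ∑ ω, g ω • (Pi.single ω 1 : G.EdgeTensor) := by
    ext η
    rw [Finset.sum_apply, Finset.sum_eq_single η]
    · simp
    · intro ω _ hω
      simp [Ne.symm hω]
    · simp
  rw [hsum]
  refine Ideal.sum_mem _ fun ω _ => ?_
  by_cases hω : ω ∈ G.zeroLocus
  · rw [h ω hω, zero_smul]
    exact Ideal.zero_mem _
  · have hω' : ∃ k ∈ G.tensorIdeal, k ω ≠ 0 := by
      by_contra hcon
      push Not at hcon
      exact hω hcon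
    obtain ⟨k, hk, hkω⟩ := hω'
    have e : g ω • (Pi.single ω 1 : G.EdgeTensor) = Pi.single ω (g ω * (k ω)⁻¹) * k := by
      ext η
      by_cases hη : η = ω
      · subst hη
        simp [hkω]
      · simp [hη]
    rw [e]
    exact Ideal.mul_mem_left _ _ hk

theorem tensorIdeal_le_comap_star :
    G.tensorIdeal ≤ G.tensorIdeal.comap (starRingEnd G.EdgeTensor) := by
  intro g hg
  rw [Ideal.mem_comap, mem_tensorIdeal]
  intro ω hω
  change star (g ω) = 0
  rw [hω g hg, star_zero]

/-- The abelian C*-algebra `D_G`, the quotient of `⊗_{e ∈ E} ℓ^∞_e` by `tensorIdeal`. -/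
def ClassicalCStar : Type u := G.EdgeTensor ⧸ G.tensorIdeal

namespace ClassicalCStar

noncomputable instance instCommRing : CommRing G.ClassicalCStar :=
  inferInstanceAs (CommRing (G.EdgeTensor ⧸ G.tensorIdeal))
noncomputable instance instAlgebra : Algebra ℂ G.ClassicalCStar :=
  inferInstanceAs (Algebra ℂ (G.EdgeTensor ⧸ G.tensorIdeal))

/-- The quotient map. -/
noncomputable def mk : G.EdgeTensor →ₐ[ℂ] G.ClassicalCStar := Ideal.Quotient.mkₐ ℂ G.tensorIdeal

theorem mk_surjective : Function.Surjective (mk G) := Ideal.Quotient.mk_surjective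

theorem mk_eq_zero {g : G.EdgeTensor} : mk G g = 0 ↔ g ∈ G.tensorIdeal :=
  Ideal.Quotient.eq_zero_iff_mem

noncomputable instance : Star G.ClassicalCStar :=
  ⟨Ideal.quotientMap G.tensorIdeal (starRingEnd G.EdgeTensor) G.tensorIdeal_le_comap_star⟩

theorem star_mk (g : G.EdgeTensor) : star (mk G g) = mk G (star g) := rfl

noncomputable instance : StarRing G.ClassicalCStar where
  star_involutive s := by
    obtain ⟨s, rfl⟩ := mk_surjective G s
    rw [star_mk, star_mk, star_star]
  star_mul s t := by
    obtain ⟨s, rfl⟩ := mk_surjective G s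
    obtain ⟨t, rfl⟩ := mk_surjective G t
    rw [← map_mul, star_mk, star_mk, star_mk, star_mul, map_mul]
  star_add s t := by
    obtain ⟨s, rfl⟩ := mk_surjective G s
    obtain ⟨t, rfl⟩ := mk_surjective G t
    rw [← map_add, star_mk, star_mk, star_mk, star_add, map_add]

instance : Finite G.zeroLocus := inferInstance

noncomputable instance : Fintype G.zeroLocus := Fintype.ofFinite _

/-- Restriction of functions to the zero locus of the ideal. -/
noncomputable def restr : G.ClassicalCStar →ₐ[ℂ] (G.zeroLocus → ℂ) :=
  Ideal.Quotient.liftₐ G.tensorIdeal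
    (AlgHom.pi fun ω : G.zeroLocus => Pi.evalAlgHom ℂ (fun _ : G.Selection => ℂ) ω.1)
    fun g hg => funext fun ω => ω.2 g hg

theorem restr_mk (g : G.EdgeTensor) (ω : G.zeroLocus) : restr G (mk G g) ω = g ω.1 := rfl

theorem restr_injective : Function.Injective (restr G) := by
  rw [injective_iff_map_eq_zero]
  intro s hs
  obtain ⟨g, rfl⟩ := mk_surjective G s
  rw [mk_eq_zero, mem_tensorIdeal]
  intro ω hω
  exact congrFun hs ⟨ω, hω⟩

theorem restr_star (s : G.ClassicalCStar) : restr G (star s) = star (restr G s) := by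
  obtain ⟨g, rfl⟩ := mk_surjective G s
  rfl

/-- The norm of `D_G` is the supremum norm on the zero locus, which is the unique C*-norm. -/
noncomputable instance : NormedCommRing G.ClassicalCStar :=
  { NormedCommRing.induced G.ClassicalCStar (G.zeroLocus → ℂ) (restr G) (restr_injective G) with
    toCommRing := instCommRing G }

theorem norm_eq (s : G.ClassicalCStar) : ‖s‖ = ‖restr G s‖ := rfl

noncomputable instance : NormedAlgebra ℂ G.ClassicalCStar where
  norm_smul_le z s := by
    rw [norm_eq, norm_eq, map_smul]
    exact norm_smul_le z _

instance : FiniteDimensional ℂ G.ClassicalCStar :=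
  Module.Finite.of_injective (restr G).toLinearMap (restr_injective G)

noncomputable instance : CStarAlgebra G.ClassicalCStar where
  toCompleteSpace := FiniteDimensional.complete ℂ _
  norm_mul_self_le s := by
    rw [norm_eq, norm_eq, map_mul, restr_star]
    exact CStarRing.norm_mul_self_le _
  star_smul z s := by
    obtain ⟨s, rfl⟩ := mk_surjective G s
    rw [← map_smul, star_mk, star_mk, star_smul, map_smul]

/-- The canonical projections `d_x`. -/
noncomputable def d (x : V) : G.ClassicalCStar :=
  mk G (G.tensorDelta (G.edgeOf x) ⟨x, G.mem_edgeOf x⟩)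

/-- The projection `d_x` does not depend on the choice of a hyperedge containing `x`. -/
theorem d_eq (e : G.Edge) (x : e.Vertex) : d G x.1 = mk G (G.tensorDelta e x) := by
  rw [d, ← sub_eq_zero, ← map_sub, mk_eq_zero]
  exact Ideal.subset_span ⟨_, _, x.1, _, _, rfl⟩

theorem star_d (x : V) : star (d G x) = d G x := by
  rw [d, star_mk]
  congr 1
  ext ω
  simp only [Pi.star_apply, tensorDelta, apply_ite star, star_one, star_zero]

theorem sum_d (e : G.Edge) : ∑ x : e.Vertex, d G x.1 = 1 := by
  simp only [d_eq]
  rw [← map_sum, ← map_one (mk G)]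
  congr 1
  ext ω
  rw [Finset.sum_apply, Finset.sum_eq_single (ω e)]
  · simp [tensorDelta]
  · intro y _ hy
    simp [tensorDelta, Ne.symm hy]
  · simp

end ClassicalCStar

theorem one_mem_span_d : (OperatorSystem.ofCStarAlgebra G.ClassicalCStar).unit ∈
    Submodule.span ℂ (Set.range (ClassicalCStar.d G)) := by
  obtain ⟨e, he⟩ := G.edges_nonempty
  change (1 : G.ClassicalCStar) ∈ _
  rw [← ClassicalCStar.sum_d G ⟨e, he⟩]
  exact Submodule.sum_mem _ fun x _ => Submodule.subset_span ⟨x.1, rfl⟩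

/-- The underlying vector space of the operator system `R_G`. -/
abbrev RSpace : Type u := OperatorSystem.SelfAdjSpan (ClassicalCStar.d G) (ClassicalCStar.star_d G)

/-- The operator system `R_G = span {d_x : x ∈ V}`, an operator subsystem of `D_G`. -/
noncomputable def R : OperatorSystem G.RSpace :=
  (OperatorSystem.ofCStarAlgebra G.ClassicalCStar).subsystem (ClassicalCStar.d G)
    (ClassicalCStar.star_d G) G.one_mem_span_d

/-- The canonical generators `d_x` of `R_G`. -/
noncomputable def d (x : V) : G.RSpace :=
  OperatorSystem.SelfAdjSpan.gen (ClassicalCStar.d G) (ClassicalCStar.star_d G) x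

end ContextualityScenario

/-! ### Archimedean order unit spaces generated by a contextuality scenario -/

/-! In each of the three operator systems the generators `w x` span the space, are positive, and add
up to the unit over every hyperedge (`IsGenerating`). Everything about the ordered space is then
encoded in one closed convex cone in `V → ℝ`, the set of real `c` with `∑ c x • w x ≥ 0`
(`coeffCone`): its lineality space gives the real linear relations between the generators, and the
cone itself gives the order. Positivity in `OMIN` is tested by scalar columns at the first level, so
two `OMIN` structures are canonically equal exactly when their coefficient cones coincide
(`canonicallyEq_iff_coeffCone`).

A functional `p` that is non-negative on this cone has non-negative values on the vertices and the
same total over every hyperedge, so it is zero or a positive multiple of a probabilistic model. By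
the bipolar theorem the cone is therefore recovered from the set of models that are non-negative on
it (`mem_coeffCone_iff`). Canonical equality thus becomes equality of two sets of models
(`canonicallyEq_iff`).

It remains to compute these sets. For `S` every model qualifies, because `S` is the quotient by the
joint kernel of all models (`dualModels_S`). For `T` they are the quantum models: one inclusion
evaluates positive elements in projective representations, the other extends a positive functional
from the span to all of `C*(G)` by the M. Riesz theorem and applies the GNS construction
(`dualModels_T`). For `R` they are the classical models: the points of the spectrum of `D_G` are the
deterministic models, and Hahn-Banach separates from their convex hull (`dualModels_R`). Finally `R`
sits in a commutative C*-algebra, so it is already minimal (`OMIN_R`). -/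

namespace OperatorSystem

variable {S T : Type*} [AddCommGroup S] [Module ℂ S] [StarAddMonoid S] [StarModule ℂ S]
  [AddCommGroup T] [Module ℂ T] [StarAddMonoid T] [StarModule ℂ T]

/-- An operator system is minimal as soon as its matrix cones contain those of `OMIN`. -/
theorem OMIN_eq_self (X : OperatorSystem S)
    (h : ∀ n, ∀ a : Matrix (Fin n) (Fin n) S, (∀ l, quad a l ∈ X.toAOUSpace.cone) → a ∈ X.pos n) :
    X.OMIN = X := by
  have hpos : X.OMIN.pos = X.pos := by
    funext n
    refine Set.Subset.antisymm (h n) fun a ha l => ?_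
    have h1 := X.compress_mem n 1 (Matrix.of fun i (_ : Fin 1) => l i) a ha
    rwa [compress_col] at h1
  have hunit : X.OMIN.unit = X.unit := rfl
  -- All fields other than `pos` and `unit` are proofs, so two structures that agree in these two
  -- are equal.
  generalize X.OMIN = Y at hpos hunit
  cases X
  cases Y
  cases hpos
  cases hunit
  rfl

theorem single_quad_single (s : S) (l : Fin 1 → ℂ) :
    quad (single s) l = ((‖l 0‖ ^ 2 : ℝ) : ℂ) • s := by
  rw [← single_diag, quad_diag]
  simp

theorem single_mem_OMIN_iff (X : AOUSpace S) (s : S) : single s ∈ X.OMIN.pos 1 ↔ s ∈ X.cone := by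
  constructor
  · intro h
    have := h fun _ => 1
    rw [single_quad_single] at this
    simpa using this
  · intro h l
    rw [single_quad_single]
    exact X.smul_mem _ (by positivity) _ h

end OperatorSystem

namespace ContextualityScenario

open OperatorSystem

variable {V : Type u} [Fintype V]

/-! ### Real coefficient vectors and their pairing with functions on the vertices. -/

section Combination

variable {W : Type*} [AddCommGroup W] [Module ℂ W]

/-- Real linear combinations of a family of vectors of a complex vector space. -/
noncomputable def realComb (w : V → W) : (V → ℝ) →ₗ[ℝ] W where
  toFun c := ∑ x, (c x : ℂ) • w x
  map_add' c d := by simp [add_smul, Finset.sum_add_distrib]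
  map_smul' r c := by simp [mul_smul, Finset.smul_sum]

theorem realComb_apply (w : V → W) (c : V → ℝ) : realComb w c = ∑ x, (c x : ℂ) • w x := rfl

theorem realComb_single [DecidableEq V] (w : V → W) (x : V) :
    realComb w (Pi.single x 1) = w x := by
  simp [realComb_apply, Pi.single_apply, apply_ite Complex.ofReal, ite_smul]

/-- The indicator function of a finite set of vertices. -/
noncomputable def indic (e : Finset V) : V → ℝ := fun x => by
  classical exact if x ∈ e then 1 else 0

theorem realComb_indic (w : V → W) (e : Finset V) : realComb w (indic e) = ∑ x ∈ e, w x := by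
  classical
  simp [realComb_apply, indic, apply_ite Complex.ofReal, ite_smul]

/-- The real pairing between coefficients and models. -/
noncomputable def dot (p : V → ℝ) : (V → ℝ) →ₗ[ℝ] ℝ where
  toFun c := ∑ x, c x * p x
  map_add' c d := by simp [add_mul, Finset.sum_add_distrib]
  map_smul' r c := by simp [mul_assoc, Finset.mul_sum]

theorem dot_apply (p c : V → ℝ) : dot p c = ∑ x, c x * p x := rfl

theorem dot_single [DecidableEq V] (p : V → ℝ) (x : V) : dot p (Pi.single x 1) = p x := by
  simp [dot_apply, Pi.single_apply]

theorem dot_indic (p : V → ℝ) (e : Finset V) : dot p (indic e) = ∑ x ∈ e, p x := by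
  classical
  simp [dot_apply, indic]

theorem eq_dot (f : (V → ℝ) →ₗ[ℝ] ℝ) : ∃ p, f = dot p := by
  classical
  refine ⟨fun x => f (Pi.single x 1), LinearMap.pi_ext' fun x => LinearMap.ext_ring ?_⟩
  simp [dot_single]

end Combination

/-! ### Duality between cones of coefficients and sets of models. -/

section Cone

variable {W W' : Type*} [AddCommGroup W] [Module ℂ W] [StarAddMonoid W] [StarModule ℂ W]
  [AddCommGroup W'] [Module ℂ W'] [StarAddMonoid W'] [StarModule ℂ W']

/-- A family of positive elements of an Archimedean order unit space that spans it and adds up to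
the unit over each hyperedge. -/
structure IsGenerating (G : ContextualityScenario V) (X : AOUSpace W) (w : V → W) : Prop where
  span_eq_top : Submodule.span ℂ (Set.range w) = ⊤
  mem_cone : ∀ x, w x ∈ X.cone
  sum_eq : ∀ e ∈ G.edges, ∑ x ∈ e, w x = X.unit

/-- The real coefficients of positive elements. -/
def coeffCone (X : AOUSpace W) (w : V → W) : Set (V → ℝ) := {c | realComb w c ∈ X.cone}

/-- The probabilistic models that are non-negative on the coefficients of positive elements. -/
def dualModels (G : ContextualityScenario V) (X : AOUSpace W) (w : V → W) : Set (V → ℝ) :=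
  {p | p ∈ G.models ∧ ∀ c ∈ coeffCone X w, 0 ≤ dot p c}

/-- The bound `p x ≤ 1` is automatic, since every vertex lies in a hyperedge of total weight one. -/
theorem mem_models_of_nonneg (G : ContextualityScenario V) {p : V → ℝ} (h0 : ∀ x, 0 ≤ p x)
    (h1 : ∀ e ∈ G.edges, ∑ x ∈ e, p x = 1) : p ∈ G.models := by
  refine ⟨fun x => ⟨h0 x, ?_⟩, h1⟩
  obtain ⟨e, he, hx⟩ := G.cover x
  exact (Finset.single_le_sum (fun y _ => h0 y) hx).trans (h1 e he).le

namespace IsGenerating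

variable {G : ContextualityScenario V} {X : AOUSpace W} {w : V → W} {Y : AOUSpace W'} {w' : V → W'}

theorem sub_mem (h : G.IsGenerating X w) (x : V) : X.unit - w x ∈ X.cone := by
  classical
  obtain ⟨e, he, hx⟩ := G.cover x
  rw [← h.sum_eq e he, ← Finset.add_sum_erase e w hx, add_sub_cancel_left]
  exact X.sum_mem _ _ fun y _ => h.mem_cone y

/-- Since `0 ≤ w x ≤ 1`, the element `r • 1 + c x • w x = r • (1 - w x) + (c x + r) • w x` is
positive for each `x`; the claim is the sum over all vertices. This compares the supremum norm of
coefficients with the order unit. -/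
theorem unit_add_mem (h : G.IsGenerating X w) {r : ℝ} {c : V → ℝ} (hr : 0 ≤ r)
    (hc : ∀ x, -r ≤ c x) : ((r * Fintype.card V : ℝ) : ℂ) • X.unit + realComb w c ∈ X.cone := by
  have h1 : ∀ x, (r : ℂ) • (X.unit - w x) + ((c x + r : ℝ) : ℂ) • w x ∈ X.cone := fun x =>
    X.add_mem _ (X.smul_mem r hr _ (h.sub_mem x)) _
      (X.smul_mem _ (by linarith [hc x]) _ (h.mem_cone x))
  have h2 := X.sum_mem Finset.univ _ fun x _ => h1 x
  convert h2 using 1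
  have h3 : ∀ x, (r : ℂ) • (X.unit - w x) + ((c x + r : ℝ) : ℂ) • w x =
      (r : ℂ) • X.unit + (c x : ℂ) • w x := fun x => by
    push_cast
    module
  simp only [h3, Finset.sum_add_distrib, realComb_apply]
  rw [Finset.sum_const, Finset.card_univ, ← Nat.cast_smul_eq_nsmul ℂ, smul_smul]
  push_cast
  rw [mul_comm]

theorem star_realComb (h : G.IsGenerating X w) (c : V → ℝ) :
    star (realComb w c) = realComb w c := by
  simp [realComb_apply, star_sum, star_smul, X.star_eq _ (h.mem_cone _)]

/-- A coefficient vector close to the cone becomes positive after adding a small multiple of the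
unit, so the Archimedean property puts limits back into the cone. -/
theorem isClosed_coeffCone (h : G.IsGenerating X w) : IsClosed (coeffCone X w) := by
  refine isClosed_of_closure_subset fun c hc => X.archimedean _ (h.star_realComb c) fun r hr => ?_
  -- `unit_add_mem` multiplies this distance by the number of vertices, which keeps it below `r`;
  -- the added one makes the denominator positive without any assumption on `V`.
  obtain ⟨d, hd, hcd⟩ := Metric.mem_closure_iff.1 hc (r / (Fintype.card V + 1)) (by positivity)
  have h1 := h.unit_add_mem (r := r / (Fintype.card V + 1)) (c := c - d) (by positivity)
    fun x => by
      have h2 := (dist_le_pi_dist c d x).trans hcd.le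
      rw [Real.dist_eq] at h2
      exact (abs_le.1 h2).1
  have h3 := X.add_mem _ (X.mono (r' := r) ?_ h1) _ hd
  · rwa [map_sub, add_assoc, sub_add_cancel] at h3
  · rw [div_mul_eq_mul_div, div_le_iff₀ (by positivity)]
    nlinarith

/-- The coefficients of positive elements as a closed convex cone. -/
def properCone (h : G.IsGenerating X w) : ProperCone ℝ (V → ℝ) where
  carrier := coeffCone X w
  add_mem' {c d} hc hd := by
    change realComb w (c + d) ∈ X.cone
    rw [map_add]
    exact X.add_mem _ hc _ hd
  zero_mem' := by
    change realComb w 0 ∈ X.cone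
    rw [map_zero]
    exact X.zero_mem
  smul_mem' r c hc := by
    change realComb w ((r : ℝ) • c) ∈ X.cone
    rw [map_smul, ← Complex.coe_smul]
    exact X.smul_mem _ r.2 _ hc
  isClosed' := h.isClosed_coeffCone

/-- The bipolar theorem for the closed cone of coefficients, with separating functionals normalised
to probabilistic models. -/
theorem mem_coeffCone_iff (h : G.IsGenerating X w) (c : V → ℝ) :
    c ∈ coeffCone X w ↔ ∀ p ∈ G.dualModels X w, 0 ≤ dot p c := by
  classical
  refine ⟨fun hc p hp => hp.2 c hc, fun hc => ?_⟩
  by_contra hcon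
  obtain ⟨f, hf, hfc⟩ := h.properCone.hyperplane_separation_point (x₀ := c) hcon
  obtain ⟨p, hp⟩ := eq_dot (f : (V → ℝ) →ₗ[ℝ] ℝ)
  have hfp : ∀ d, f d = dot p d := fun d => LinearMap.congr_fun hp d
  replace hf : ∀ d ∈ coeffCone X w, 0 ≤ dot p d := fun d hd => hfp d ▸ hf d hd
  rw [hfp] at hfc
  have h0 : ∀ x, 0 ≤ p x := fun x => by
    rw [← dot_single p x]
    refine hf _ ?_
    change realComb w _ ∈ X.cone
    rw [realComb_single]
    exact h.mem_cone x
  -- Both hyperedges sum to the unit, so the difference of their indicators represents zero and lies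
  -- in the cone.
  have hle : ∀ e ∈ G.edges, ∀ e' ∈ G.edges, ∑ x ∈ e, p x ≤ ∑ x ∈ e', p x := fun e he e' he' => by
    rw [← sub_nonneg, ← dot_indic, ← dot_indic, ← map_sub]
    refine hf _ ?_
    change realComb w _ ∈ X.cone
    rw [map_sub, realComb_indic, realComb_indic, h.sum_eq e he, h.sum_eq e' he', sub_self]
    exact X.zero_mem
  obtain ⟨e₀, he₀⟩ := G.edges_nonempty
  set t := ∑ x ∈ e₀, p x with ht
  have hsum : ∀ e ∈ G.edges, ∑ x ∈ e, p x = t := fun e he =>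
    le_antisymm (hle e he e₀ he₀) (hle e₀ he₀ e he)
  have ht0 : 0 ≤ t := Finset.sum_nonneg fun x _ => h0 x
  -- If the common total is zero, then `p = 0` because the hyperedges cover `V`, against strict
  -- separation. Otherwise dividing by the total gives a model that is still negative at `c`.
  rcases ht0.eq_or_lt with ht0 | ht0
  · have hp0 : p = 0 := by
      funext x
      obtain ⟨e, he, hx⟩ := G.cover x
      exact (Finset.sum_eq_zero_iff_of_nonneg fun y _ => h0 y).1 ((hsum e he).trans ht0.symm) x hx
    simp [hp0, dot_apply] at hfc
  · have hdot : ∀ d, dot (t⁻¹ • p) d = t⁻¹ * dot p d := fun d => by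
      simp [dot_apply, Finset.mul_sum, mul_left_comm]
    have := hc (t⁻¹ • p) ⟨G.mem_models_of_nonneg
      (fun x => mul_nonneg (inv_nonneg.2 ht0.le) (h0 x)) fun e he => ?_, fun d hd => ?_⟩
    · rw [hdot] at this
      exact absurd (mul_neg_of_pos_of_neg (inv_pos.2 ht0) hfc) this.not_gt
    · simp only [Pi.smul_apply, smul_eq_mul, ← Finset.mul_sum, hsum e he]
      exact inv_mul_cancel₀ ht0.ne'
    · rw [hdot]
      exact mul_nonneg (inv_nonneg.2 ht0.le) (hf d hd)

theorem dualModels_eq_iff (h : G.IsGenerating X w) (h' : G.IsGenerating Y w') :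
    G.dualModels X w = G.dualModels Y w' ↔ coeffCone X w = coeffCone Y w' := by
  constructor
  · intro heq
    ext c
    rw [h.mem_coeffCone_iff, h'.mem_coeffCone_iff, heq]
  · intro heq
    simp only [dualModels, heq]

/-! ### Canonical equality of `OMIN` structures in terms of coefficient cones. -/

theorem linearCombination_surjective (h : G.IsGenerating X w) :
    Function.Surjective (Fintype.linearCombination ℂ w) := by
  rw [← LinearMap.range_eq_top, Fintype.range_linearCombination, h.span_eq_top]

theorem linearCombination_eq (w : V → W) (z : V → ℂ) : Fintype.linearCombination ℂ w z =
    realComb w (fun x => (z x).re) + Complex.I • realComb w fun x => (z x).im := by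
  simp only [Fintype.linearCombination_apply, realComb_apply, Finset.smul_sum, smul_smul,
    ← Finset.sum_add_distrib, ← add_smul]
  refine Finset.sum_congr rfl fun x _ => ?_
  rw [mul_comm Complex.I, Complex.re_add_im]

theorem star_linearCombination (h : G.IsGenerating X w) (z : V → ℂ) :
    star (Fintype.linearCombination ℂ w z) =
      realComb w (fun x => (z x).re) - Complex.I • realComb w fun x => (z x).im := by
  rw [linearCombination_eq, star_add, star_smul, h.star_realComb, h.star_realComb,
    Complex.star_def, Complex.conj_I, neg_smul, sub_eq_add_neg]

/-- Real combinations of the generators are self-adjoint, so equating the combination with its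
adjoint forces the imaginary parts of the coefficients to contribute zero, although they need not
vanish themselves. -/
theorem eq_realComb (h : G.IsGenerating X w) {z : V → ℂ}
    (hz : star (Fintype.linearCombination ℂ w z) = Fintype.linearCombination ℂ w z) :
    Fintype.linearCombination ℂ w z = realComb w fun x => (z x).re := by
  have h2 := hz
  rw [h.star_linearCombination, linearCombination_eq, sub_eq_add_neg, add_right_inj,
    neg_eq_iff_add_eq_zero, ← two_smul ℂ, smul_eq_zero] at h2
  rw [linearCombination_eq, h2.resolve_left two_ne_zero, add_zero]

theorem exists_realComb (h : G.IsGenerating X w) {s : W} (hs : star s = s) :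
    ∃ c, s = realComb w c := by
  obtain ⟨z, rfl⟩ := h.linearCombination_surjective s
  exact ⟨_, h.eq_realComb hs⟩

/-- Properness of the order cone: the real relations between the generators form the lineality space
of the coefficient cone. Hence the cone determines the vector space as well as its order. -/
theorem realComb_eq_zero_iff (c : V → ℝ) :
    realComb w c = 0 ↔ c ∈ coeffCone X w ∧ -c ∈ coeffCone X w := by
  change _ ↔ realComb w c ∈ X.cone ∧ realComb w (-c) ∈ X.cone
  rw [map_neg]
  exact ⟨fun h0 => by simp [h0, X.zero_mem], fun h0 => X.proper _ h0.1 h0.2⟩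

theorem linearCombination_eq_zero_iff (h : G.IsGenerating X w) (z : V → ℂ) :
    Fintype.linearCombination ℂ w z = 0 ↔
      realComb w (fun x => (z x).re) = 0 ∧ realComb w (fun x => (z x).im) = 0 := by
  constructor
  · intro h0
    have h1 := h.eq_realComb (z := z) (by rw [h0, star_zero])
    rw [h0] at h1
    refine ⟨h1.symm, ?_⟩
    rw [linearCombination_eq, ← h1, zero_add, smul_eq_zero] at h0
    exact h0.resolve_left Complex.I_ne_zero
  · rintro ⟨h1, h2⟩
    rw [linearCombination_eq, h1, h2, smul_zero, add_zero]

theorem map_realComb (φ : W →ₗ[ℂ] W') (hφ : ∀ x, φ (w x) = w' x) (c : V → ℝ) :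
    φ (realComb w c) = realComb w' c := by
  simp [realComb_apply, hφ]

theorem map_unit (h : G.IsGenerating X w) (h' : G.IsGenerating Y w') (φ : W →ₗ[ℂ] W')
    (hφ : ∀ x, φ (w x) = w' x) : φ X.unit = Y.unit := by
  obtain ⟨e, he⟩ := G.edges_nonempty
  rw [← h.sum_eq e he, ← h'.sum_eq e he, map_sum]
  simp only [hφ]

/-- Matrix positivity in `OMIN` is a condition on the first-level elements `quad a l`. These are
self-adjoint, hence real combinations of generators, and `φ` keeps their coefficients. -/
theorem isCompletelyPositive (h : G.IsGenerating X w) (φ : W →ₗ[ℂ] W')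
    (hφ : ∀ x, φ (w x) = w' x) (hle : coeffCone X w ⊆ coeffCone Y w') :
    IsCompletelyPositive X.OMIN Y.OMIN φ := fun n a ha l => by
  rw [quad_map]
  obtain ⟨c, hc⟩ := h.exists_realComb (X.star_eq _ (ha l))
  rw [hc, map_realComb φ hφ]
  refine hle ?_
  change realComb w c ∈ X.cone
  rw [← hc]
  exact ha l

theorem coeffCone_subset (φ : W →ₗ[ℂ] W')
    (hφ : ∀ x, φ (w x) = w' x) (hcp : IsCompletelyPositive X.OMIN Y.OMIN φ) :
    coeffCone X w ⊆ coeffCone Y w' := fun c hc => by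
  have h1 := hcp 1 (single (realComb w c)) ((single_mem_OMIN_iff X _).2 hc)
  have h2 : (single (realComb w c)).map φ = single (realComb w' c) := by
    ext i j
    exact map_realComb φ hφ c
  rw [h2] at h1
  exact (single_mem_OMIN_iff Y _).1 h1

/-- Equal cones give equal relations between the two families of generators, so both spaces are the
same quotient of `V → ℂ`. The resulting linear isomorphism and its inverse preserve positivity
because the cones agree. -/
theorem canonicallyEq_iff_coeffCone (h : G.IsGenerating X w) (h' : G.IsGenerating Y w') :
    CanonicallyEq X.OMIN Y.OMIN w w' ↔ coeffCone X w = coeffCone Y w' := by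
  classical
  constructor
  · rintro ⟨φ, hφ, -, h1, h2⟩
    exact Set.Subset.antisymm (coeffCone_subset φ.toLinearMap hφ h1)
      (coeffCone_subset φ.symm.toLinearMap (fun x => (φ.symm_apply_eq).2 (hφ x).symm) h2)
  · intro heq
    have hker : LinearMap.ker (Fintype.linearCombination ℂ w) =
        LinearMap.ker (Fintype.linearCombination ℂ w') := by
      ext z
      rw [LinearMap.mem_ker, LinearMap.mem_ker, h.linearCombination_eq_zero_iff,
        h'.linearCombination_eq_zero_iff]
      simp only [realComb_eq_zero_iff (X := X), realComb_eq_zero_iff (X := Y), heq]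
    let φ : W ≃ₗ[ℂ] W' :=
      ((Fintype.linearCombination ℂ w).quotKerEquivOfSurjective
        h.linearCombination_surjective).symm ≪≫ₗ Submodule.quotEquivOfEq _ _ hker ≪≫ₗ
      (Fintype.linearCombination ℂ w').quotKerEquivOfSurjective h'.linearCombination_surjective
    have hφ : ∀ x, φ (w x) = w' x := fun x => by
      have h1 : ((Fintype.linearCombination ℂ w).quotKerEquivOfSurjective
          h.linearCombination_surjective).symm (w x) =
          Submodule.Quotient.mk (Pi.single x 1) := by
        rw [LinearEquiv.symm_apply_eq]
        simp [LinearMap.quotKerEquivOfSurjective_apply_mk]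
      simp only [φ, LinearEquiv.trans_apply, h1, Submodule.quotEquivOfEq_mk,
        LinearMap.quotKerEquivOfSurjective_apply_mk]
      simp
    exact ⟨φ, hφ, h.map_unit h' φ.toLinearMap hφ,
      h.isCompletelyPositive φ.toLinearMap hφ heq.subset,
      h'.isCompletelyPositive φ.symm.toLinearMap
        (fun x => (φ.symm_apply_eq).2 (hφ x).symm) heq.symm.subset⟩

theorem canonicallyEq_iff (h : G.IsGenerating X w) (h' : G.IsGenerating Y w') :
    CanonicallyEq X.OMIN Y.OMIN w w' ↔ G.dualModels X w = G.dualModels Y w' := by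
  rw [h.dualModels_eq_iff h', h.canonicallyEq_iff_coeffCone h']

end IsGenerating

end Cone

end ContextualityScenario

/-! ### General models -/

namespace OperatorSystem

variable {S : Type*} [AddCommGroup S] [Module ℂ S] [StarAddMonoid S] [StarModule ℂ S]

/-! ### First-level positivity in C*-algebras, subsystems and quotients. -/

theorem single_mem_ofCStarAlgebra_iff {A : Type*} [CStarAlgebra A] (a : A) :
    single a ∈ (ofCStarAlgebra A).pos 1 ↔ ∃ b, a = star b * b := by
  constructor
  · rintro ⟨b, hb⟩
    refine ⟨b 0 0, ?_⟩
    have := congrFun (congrFun hb 0) 0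
    rw [Matrix.mul_apply] at this
    simpa [single] using this
  · rintro ⟨b, rfl⟩
    refine ⟨single b, ?_⟩
    ext i j
    simp [Matrix.mul_apply, single]

theorem mem_subsystem_cone_iff {A : Type*} [CStarAlgebra A] {V : Type*} {b : V → A}
    {hb : ∀ x, star (b x) = b x} {h1 : (ofCStarAlgebra A).unit ∈ Submodule.span ℂ (Set.range b)}
    (s : SelfAdjSpan b hb) : s ∈ ((ofCStarAlgebra A).subsystem b hb h1).toAOUSpace.cone ↔
      ∃ c, SelfAdjSpan.incl b hb s = star c * c := by
  rw [← single_mem_ofCStarAlgebra_iff]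
  rfl

theorem span_range_gen {V : Type*} (b : V → S) (hb : ∀ x, star (b x) = b x) :
    Submodule.span ℂ (Set.range (SelfAdjSpan.gen b hb)) = ⊤ := by
  refine Submodule.map_injective_of_injective (f := SelfAdjSpan.incl b hb)
    SelfAdjSpan.incl_injective ?_
  rw [Submodule.map_span, ← Set.range_comp, Submodule.map_top]
  exact (Submodule.range_subtype _).symm

theorem incl_gen {V : Type*} (b : V → S) (hb : ∀ x, star (b x) = b x) (x : V) :
    SelfAdjSpan.incl b hb (SelfAdjSpan.gen b hb x) = b x := rfl

theorem mem_quotient_cone_of_mem {X : OperatorSystem S} {J : Submodule ℂ S} {hJ : X.IsKernel J}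
    {s : S} (hs : s ∈ X.toAOUSpace.cone) :
    Quot.mk X J hJ s ∈ (X.quotient J hJ).toAOUSpace.cone := fun r hr => by
  refine ⟨(r : ℂ) • diag 1 X.unit + single s, X.add_mem 1 _ (X.smul_diag_mem 1 hr.le) _ hs, ?_⟩
  rw [Matrix.map_add _ (map_add _), Matrix.map_smul _ _ (fun _ => map_smul _ _ _), Quot.map_diag]
  rfl

theorem exists_lift_of_mem_quotient_cone {X : OperatorSystem S} {J : Submodule ℂ S}
    {hJ : X.IsKernel J} {s : X.Quot J hJ} (hs : s ∈ (X.quotient J hJ).toAOUSpace.cone) {r : ℝ}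
    (hr : 0 < r) : ∃ t ∈ X.toAOUSpace.cone,
      Quot.mk X J hJ t = (r : ℂ) • Quot.mk X J hJ X.unit + s := by
  obtain ⟨b, hb, h⟩ := hs r hr
  refine ⟨b 0 0, ?_, ?_⟩
  · have : single (b 0 0) = b := by
      ext i j
      rw [Subsingleton.elim i 0, Subsingleton.elim j 0]
      rfl
    change single (b 0 0) ∈ X.pos 1
    rwa [this]
  · simpa [single, diag] using congrFun (congrFun h 0) 0

end OperatorSystem

namespace ContextualityScenario

open OperatorSystem

variable {V : Type u} (G : ContextualityScenario V)

theorem card_edges_ne_zero : (G.edges.card : ℂ) ≠ 0 := by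
  simpa using G.edges_nonempty.ne_empty

/-- Pairing with a probabilistic model, on the operator system `S_G`. -/
noncomputable def quotPairing {p : V → ℝ} (hp : p ∈ G.models) : G.SSpace →ₗ[ℂ] ℂ :=
  G.nullSpace.liftQ (G.pairing p) fun _ hu => G.mem_nullSpace.1 hu p hp

theorem quotPairing_mk {p : V → ℝ} (hp : p ∈ G.models) (u : G.EdgeSum) :
    G.quotPairing hp (OperatorSystem.Quot.mk _ G.nullSpace G.isKernel_nullSpace u) = G.pairing p u := rfl

theorem quotPairing_a {p : V → ℝ} (hp : p ∈ G.models) (x : V) :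
    G.quotPairing hp (G.a x) = G.edges.card * p x := by
  rw [a, map_smul, quotPairing_mk, pairing_delta, smul_eq_mul]

theorem pairing_nonneg {p : V → ℝ} (hp : p ∈ G.models) {u : G.EdgeSum}
    (hu : u ∈ (ofCStarAlgebra G.EdgeSum).toAOUSpace.cone) : 0 ≤ G.pairing p u := by
  obtain ⟨b, rfl⟩ := (single_mem_ofCStarAlgebra_iff u).1 hu
  exact Finset.sum_nonneg fun e _ => Finset.sum_nonneg fun x _ =>
    mul_nonneg (Complex.zero_le_real.2 (hp.1 x.1).1) (star_mul_self_nonneg (b e x))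

/-- A positive element of the quotient has a positive lift only after a small multiple of the unit
is added, so non-negativity is obtained up to an arbitrary `ε`. -/
theorem quotPairing_nonneg {p : V → ℝ} (hp : p ∈ G.models) {s : G.SSpace}
    (hs : s ∈ G.S.toAOUSpace.cone) : 0 ≤ (G.quotPairing hp s).re := by
  have hcard : (0 : ℝ) < G.edges.card := by exact_mod_cast G.edges_nonempty.card_pos
  refine le_of_forall_pos_le_add fun ε hε => ?_
  -- A model pairs with the unit of the direct sum to the number of hyperedges, so this choice makes
  -- the correction exactly `ε`.
  obtain ⟨t, ht, hts⟩ := exists_lift_of_mem_quotient_cone hs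
    (r := ε / G.edges.card) (by positivity)
  have h1 := G.pairing_nonneg hp ht
  rw [← G.quotPairing_mk hp, hts, map_add, map_smul, quotPairing_mk] at h1
  change 0 ≤ (_ : ℂ) • G.pairing p 1 + _ at h1
  rw [G.pairing_one hp, smul_eq_mul] at h1
  have h2 := (Complex.nonneg_iff.1 h1).1
  have h3 : (((ε / G.edges.card : ℝ) : ℂ) * (G.edges.card : ℂ)) = (ε : ℂ) := by
    rw [← Complex.ofReal_natCast, ← Complex.ofReal_mul, div_mul_cancel₀ _ hcard.ne']
  rw [h3, Complex.add_re, Complex.ofReal_re] at h2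
  linarith

theorem delta_mem_cone (e : G.Edge) (x : e.Vertex) :
    G.delta e x ∈ (ofCStarAlgebra G.EdgeSum).toAOUSpace.cone := by
  classical
  refine (single_mem_ofCStarAlgebra_iff _).2 ⟨G.delta e x, ?_⟩
  simp only [delta]
  rw [← Pi.single_star, ← Pi.single_star, star_one, ← Pi.single_mul, ← Pi.single_mul, one_mul]

variable [Fintype V]

theorem isGenerating_S : G.IsGenerating G.S.toAOUSpace G.a where
  span_eq_top := by
    classical
    have h1 : Submodule.span ℂ (Set.range fun y : (e : G.Edge) × e.Vertex => G.delta y.1 y.2) = ⊤ := by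
      refine eq_top_iff.2 fun u _ => ?_
      have : u = ∑ e : G.Edge, ∑ x : e.Vertex, u e x • G.delta e x := by
        ext e x
        rw [Finset.sum_apply, Finset.sum_apply, Finset.sum_eq_single e, Finset.sum_apply,
          Finset.sum_apply, Finset.sum_eq_single x]
        · simp [delta]
        · intro y _ hy
          simp [delta, hy.symm]
        · simp
        · intro f _ hf
          simp [delta, hf.symm]
        · simp
      rw [this]
      exact Submodule.sum_mem _ fun e _ => Submodule.sum_mem _ fun x _ =>
        Submodule.smul_mem _ _ (Submodule.subset_span ⟨⟨e, x⟩, rfl⟩)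
    refine eq_top_iff.2 ?_
    rw [← LinearMap.range_eq_top.2 (OperatorSystem.Quot.mk_surjective (hJ := G.isKernel_nullSpace)),
      LinearMap.range_eq_map, ← h1, Submodule.map_span, Submodule.span_le]
    rintro _ ⟨_, ⟨⟨e, x⟩, rfl⟩, rfl⟩
    have : OperatorSystem.Quot.mk (ofCStarAlgebra G.EdgeSum) G.nullSpace G.isKernel_nullSpace (G.delta e x) =
        (G.edges.card : ℂ)⁻¹ • G.a x.1 := by
      rw [G.a_eq e x, smul_smul, inv_mul_cancel₀ G.card_edges_ne_zero, one_smul]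
    change OperatorSystem.Quot.mk _ _ _ (G.delta e x) ∈ _
    rw [this]
    exact Submodule.smul_mem _ _ (Submodule.subset_span ⟨_, rfl⟩)
  mem_cone x := by
    have := G.S.toAOUSpace.smul_mem (G.edges.card : ℝ) (Nat.cast_nonneg _) _
      (mem_quotient_cone_of_mem (hJ := G.isKernel_nullSpace)
        (G.delta_mem_cone (G.edgeOf x) ⟨x, G.mem_edgeOf x⟩))
    rwa [Complex.ofReal_natCast] at this
  sum_eq e he := by
    rw [← Finset.sum_coe_sort]
    simp only [G.a_eq ⟨e, he⟩]
    rw [← Finset.smul_sum, ← map_sum, ← map_smul]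
    change _ = OperatorSystem.Quot.mk _ _ _ 1
    -- The sum of the rescaled `delta` over a single hyperedge need not be the unit of the direct
    -- sum, but every model pairs with both to the number of hyperedges, so they agree in the
    -- quotient.
    rw [← sub_eq_zero, ← map_sub, OperatorSystem.Quot.mk_eq_zero, mem_nullSpace]
    intro p hp
    have hsum := hp.2 e he
    rw [← Finset.sum_coe_sort] at hsum
    rw [map_sub, map_smul, map_sum, G.pairing_one hp]
    simp only [pairing_delta]
    rw [← Complex.ofReal_sum, hsum, Complex.ofReal_one, smul_eq_mul, mul_one, sub_self]

/-- Every model descends to a positive functional on the quotient, whose value on a real combination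
of the `a x` is a positive multiple of `dot p c`. -/
theorem dualModels_S : G.dualModels G.S.toAOUSpace G.a = G.models := by
  refine Set.Subset.antisymm (fun p hp => hp.1) fun p hp => ⟨hp, fun c hc => ?_⟩
  have hcard : (0 : ℝ) < G.edges.card := by exact_mod_cast G.edges_nonempty.card_pos
  have h1 := G.quotPairing_nonneg hp hc
  have h2 : G.quotPairing hp (realComb G.a c) = ((G.edges.card * dot p c : ℝ) : ℂ) := by
    simp only [realComb_apply, map_sum, map_smul, quotPairing_a, dot_apply, Finset.mul_sum,
      smul_eq_mul]
    push_cast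
    exact Finset.sum_congr rfl fun x _ => by ring
  rw [h2, Complex.ofReal_re] at h1
  exact nonneg_of_mul_nonneg_right h1 hcard

/-! ### Classical models -/

theorem isGenerating_R : G.IsGenerating G.R.toAOUSpace G.d where
  span_eq_top := span_range_gen _ _
  mem_cone x := (mem_subsystem_cone_iff _).2 ⟨ClassicalCStar.d G x, by
    change ClassicalCStar.d G x = _
    rw [ClassicalCStar.star_d, ClassicalCStar.d, ← map_mul]
    congr 1
    ext ω
    simp [tensorDelta]⟩
  sum_eq e he := SelfAdjSpan.incl_injective (by
    rw [map_sum]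
    change ∑ x ∈ e, ClassicalCStar.d G x = 1
    rw [← ClassicalCStar.sum_d G ⟨e, he⟩]
    exact (Finset.sum_coe_sort e _).symm)

/-- The deterministic model given by a point of the zero locus. -/
noncomputable def modelOf (ω : G.zeroLocus) (x : V) : ℝ := by
  classical exact if ω.1 (G.edgeOf x) = ⟨x, G.mem_edgeOf x⟩ then 1 else 0

theorem restr_d (ω : G.zeroLocus) (x : V) :
    ClassicalCStar.restr G (ClassicalCStar.d G x) ω = G.modelOf ω x := by
  rw [ClassicalCStar.d, ClassicalCStar.restr_mk]
  simp [tensorDelta, modelOf, apply_ite Complex.ofReal]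

theorem modelOf_eq (ω : G.zeroLocus) (x : V) : G.modelOf ω x = 0 ∨ G.modelOf ω x = 1 := by
  rw [modelOf]
  split <;> simp

theorem modelOf_mem (ω : G.zeroLocus) : G.modelOf ω ∈ G.deterministicModels := by
  refine ⟨G.mem_models_of_nonneg (fun x => ?_) fun e he => ?_, G.modelOf_eq ω⟩
  · rcases G.modelOf_eq ω x with h | h <;> simp [h]
  · have h1 := congrFun (congrArg (ClassicalCStar.restr G) (ClassicalCStar.sum_d G ⟨e, he⟩)) ω
    rw [map_sum, Finset.sum_apply, map_one] at h1
    simp only [restr_d] at h1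
    rw [← Finset.sum_coe_sort]
    rw [← Complex.ofReal_sum] at h1
    exact Complex.ofReal_injective h1

/-- A deterministic model takes the value one at exactly one vertex of each hyperedge, which defines
a selection. Each `tensorDelta e x` has the value `q x` there, independently of `e`, so the
generators of the ideal vanish at it. -/
theorem exists_modelOf {q : V → ℝ} (hq : q ∈ G.deterministicModels) :
    ∃ ω : G.zeroLocus, G.modelOf ω = q := by
  classical
  have hex : ∀ e : G.Edge, ∃ x : e.Vertex, q x.1 = 1 := fun e => by
    by_contra! hcon
    have h0 := hq.1.2 e.1 e.2
    rw [Finset.sum_eq_zero fun x hx => (hq.2 x).resolve_right (hcon ⟨x, hx⟩)] at h0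
    exact zero_ne_one h0
  choose ω hω using hex
  have key : ∀ (e : G.Edge) (x : e.Vertex), (if ω e = x then (1 : ℝ) else 0) = q x.1 := by
    intro e x
    split_ifs with h
    · rw [← h, hω]
    · refine ((hq.2 x.1).resolve_right fun h1 => ?_).symm
      have hsum := hq.1.2 e.1 e.2
      rw [← Finset.sum_coe_sort] at hsum
      -- Two distinct vertices of value one would make the total over the hyperedge at least two.
      have h2 := Finset.sum_le_sum_of_subset_of_nonneg (f := fun y : e.Vertex => q y.1)
        (Finset.subset_univ {ω e, x}) fun y _ _ => (hq.1.1 y.1).1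
      rw [Finset.sum_pair h, hω, h1, hsum] at h2
      norm_num at h2
  have key' : ∀ (e : G.Edge) (x : e.Vertex), G.tensorDelta e x ω = (q x.1 : ℂ) := fun e x => by
    rw [← key e x]
    simp [tensorDelta, apply_ite Complex.ofReal]
  have hmem : ω ∈ G.zeroLocus := fun g hg => by
    induction hg using Submodule.span_induction with
    | mem g hg =>
      obtain ⟨e, f, x, he, hf, rfl⟩ := hg
      rw [Pi.sub_apply, key', key', sub_self]
    | zero => rfl
    | add g k _ _ h h' => rw [Pi.add_apply, h, h', add_zero]
    | smul k g _ h => rw [Pi.smul_apply', h, smul_zero]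
  refine ⟨⟨ω, hmem⟩, funext fun x => ?_⟩
  rw [← key (G.edgeOf x) ⟨x, G.mem_edgeOf x⟩, modelOf]

/-- Extension by zero. Together with `restr_injective` this identifies `D_G` with all functions on
the finite zero locus, so positivity and square roots there are pointwise. -/
theorem restr_surjective : Function.Surjective (ClassicalCStar.restr G) := fun g => by
  classical
  refine ⟨ClassicalCStar.mk G fun ω => if h : ω ∈ G.zeroLocus then g ⟨ω, h⟩ else 0, ?_⟩
  ext ω
  rw [ClassicalCStar.restr_mk]
  simp

theorem exists_star_mul_self_iff (s : G.ClassicalCStar) :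
    (∃ c, s = star c * c) ↔ ∀ ω, 0 ≤ ClassicalCStar.restr G s ω := by
  constructor
  · rintro ⟨c, rfl⟩ ω
    rw [map_mul, ClassicalCStar.restr_star]
    exact star_mul_self_nonneg (ClassicalCStar.restr G c ω)
  · intro h
    obtain ⟨c, hc⟩ := G.restr_surjective fun ω => ((√(ClassicalCStar.restr G s ω).re : ℝ) : ℂ)
    refine ⟨c, ClassicalCStar.restr_injective G ?_⟩
    rw [map_mul, ClassicalCStar.restr_star, hc]
    ext ω
    obtain ⟨h1, h2⟩ := Complex.nonneg_iff.1 (h ω)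
    simp only [Pi.mul_apply, Pi.star_apply, Complex.star_def, Complex.conj_ofReal]
    rw [← Complex.ofReal_mul, Real.mul_self_sqrt h1]
    exact Complex.ext rfl h2.symm

theorem mem_coeffCone_R_iff (c : V → ℝ) :
    c ∈ coeffCone G.R.toAOUSpace G.d ↔ ∀ q ∈ G.deterministicModels, 0 ≤ dot q c := by
  have h1 : c ∈ coeffCone G.R.toAOUSpace G.d ↔ ∀ ω, 0 ≤ ClassicalCStar.restr G
      (SelfAdjSpan.incl _ _ (realComb G.d c)) ω := by
    rw [← exists_star_mul_self_iff]
    exact mem_subsystem_cone_iff (h1 := G.one_mem_span_d) _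
  have h2 : ∀ ω, ClassicalCStar.restr G (SelfAdjSpan.incl _ _ (realComb G.d c)) ω =
      (dot (G.modelOf ω) c : ℂ) := fun ω => by
    simp only [realComb_apply, map_sum, map_smul, d, incl_gen, Finset.sum_apply, Pi.smul_apply,
      restr_d, dot_apply, smul_eq_mul]
    push_cast
    rfl
  simp only [h1, h2, Complex.zero_le_real]
  refine ⟨fun h q hq => ?_, fun h ω => h _ (G.modelOf_mem ω)⟩
  obtain ⟨ω, rfl⟩ := G.exists_modelOf hq
  exact h ω

/-- Finiteness makes the convex hull closed, as the separation in `dualModels_R` requires. -/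
theorem finite_deterministicModels : G.deterministicModels.Finite := by
  refine (Set.finite_range G.modelOf).subset fun q hq => ?_
  obtain ⟨ω, rfl⟩ := G.exists_modelOf hq
  exact ⟨ω, rfl⟩

theorem convex_models : Convex ℝ G.models := by
  intro p hp q hq s t hs ht hst
  refine G.mem_models_of_nonneg (fun x => ?_) fun e he => ?_
  · exact add_nonneg (mul_nonneg hs (hp.1 x).1) (mul_nonneg ht (hq.1 x).1)
  · simp only [Pi.add_apply, Pi.smul_apply, smul_eq_mul, Finset.sum_add_distrib, ← Finset.mul_sum,
      hp.2 e he, hq.2 e he, mul_one, hst]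

/-- A coefficient vector is positive in `R` exactly when it is non-negative on all deterministic
models, so the claim is that a model satisfying all these inequalities lies in their convex hull. -/
theorem dualModels_R : G.dualModels G.R.toAOUSpace G.d = G.classicalModels := by
  refine Set.Subset.antisymm (fun p hp => ?_) fun p hp =>
    ⟨convexHull_min (fun q hq => hq.1) G.convex_models hp, fun c hc => ?_⟩
  · by_contra hcon
    obtain ⟨f, u, hfp, hf⟩ := geometric_hahn_banach_point_closed (convex_convexHull ℝ _)
      (G.finite_deterministicModels.isClosed_convexHull ℝ) hcon
    obtain ⟨c, hc⟩ := eq_dot (f : (V → ℝ) →ₗ[ℝ] ℝ)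
    have hfc : ∀ q, f q = dot q c := fun q => by
      rw [show f q = dot c q from LinearMap.congr_fun hc q, dot_apply, dot_apply]
      exact Finset.sum_congr rfl fun x _ => mul_comm _ _
    obtain ⟨e, he⟩ := G.edges_nonempty
    -- Models have total one on `e`, so the constant `u` of the affine separation is absorbed into
    -- the linear pairing. The resulting vector is positive in `R` but negative at `p`.
    have hval : ∀ q ∈ G.models, dot q (c - u • indic e) = f q - u := fun q hq => by
      rw [map_sub, map_smul, dot_indic, hq.2 e he, hfc, smul_eq_mul, mul_one]
    have h1 := hp.2 (c - u • indic e) ((G.mem_coeffCone_R_iff _).2 fun q hq => by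
      rw [hval q hq.1]
      exact sub_nonneg.2 (hf q (subset_convexHull ℝ _ hq)).le)
    rw [hval p hp.1] at h1
    linarith
  · rw [mem_coeffCone_R_iff] at hc
    have hcvx : Convex ℝ {q : V → ℝ | 0 ≤ dot q c} := by
      intro q hq r hr s t hs ht _
      have : dot (s • q + t • r) c = s * dot q c + t * dot r c := by
        simp only [dot_apply, Finset.mul_sum, ← Finset.sum_add_distrib]
        refine Finset.sum_congr rfl fun x _ => ?_
        simp only [Pi.add_apply, Pi.smul_apply, smul_eq_mul]
        ring
      change 0 ≤ dot _ c
      rw [this]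
      exact add_nonneg (mul_nonneg hs hq) (mul_nonneg ht hr)
    exact convexHull_min hc hcvx hp

/-! ### Minimality of the operator system of classical models. -/

open scoped MatrixOrder Matrix.Norms.L2Operator in
theorem exists_eq_conjTranspose_mul_self {n : ℕ} {M : Matrix (Fin n) (Fin n) ℂ}
    (hM : M.PosSemidef) : ∃ B : Matrix (Fin n) (Fin n) ℂ, M = B.conjTranspose * B :=
  CStarAlgebra.nonneg_iff_eq_star_mul_self.1 hM.nonneg

/-- A matrix over `D_G` is a family of scalar matrices indexed by the finite zero locus. Testing
with all scalar columns says that each of them is positive semidefinite, and pointwise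
factorisations combine to one over `D_G`. -/
theorem OMIN_R : G.R.OMIN = G.R := by
  classical
  refine OMIN_eq_self _ fun n a ha => ?_
  have h1 : ∀ l ω, 0 ≤ ClassicalCStar.restr G (SelfAdjSpan.incl _ _ (quad a l)) ω := fun l =>
    (G.exists_star_mul_self_iff _).1 ((mem_subsystem_cone_iff _).1 (ha l))
  let A : G.zeroLocus → Matrix (Fin n) (Fin n) ℂ := fun ω => Matrix.of fun i j =>
    ClassicalCStar.restr G (SelfAdjSpan.incl _ _ (a i j)) ω
  have hA : ∀ ω, ∃ B : Matrix (Fin n) (Fin n) ℂ, A ω = B.conjTranspose * B := fun ω => by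
    refine exists_eq_conjTranspose_mul_self
      (Matrix.posSemidef_iff_dotProduct_mulVec.2 ⟨?_, fun l => ?_⟩)
    · ext i j
      have := congrFun (congrFun (G.R.toAOUSpace.OMIN.conjTranspose_eq n a ha) i) j
      simp only [A, Matrix.conjTranspose_apply, Matrix.of_apply]
      rw [← this, Matrix.conjTranspose_apply, SelfAdjSpan.incl_star, ClassicalCStar.restr_star]
      rfl
    convert h1 l ω using 1
    simp only [quad, map_sum, map_smul, Finset.sum_apply, Pi.smul_apply, dotProduct, Matrix.mulVec,
      Finset.mul_sum, smul_eq_mul, Pi.star_apply, A, Matrix.of_apply]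
    exact Finset.sum_congr rfl fun i _ => Finset.sum_congr rfl fun j _ => by ring
  choose B hB using hA
  -- The factor has entries in `D_G`, not necessarily in the span of the `d x`; this suffices
  -- because the cones of `R` are inherited from `D_G`.
  choose b hb using fun i j => G.restr_surjective fun ω => B ω i j
  refine ⟨Matrix.of b, ?_⟩
  ext i j
  refine ClassicalCStar.restr_injective G (funext fun ω => ?_)
  have := congrFun (congrFun (hB ω) i) j
  simp only [A, Matrix.of_apply, Matrix.mul_apply, Matrix.conjTranspose_apply] at this
  rw [Matrix.map_apply, this, Matrix.mul_apply, map_sum, Finset.sum_apply]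
  simp [Matrix.conjTranspose_apply, map_mul, ClassicalCStar.restr_star, hb]

end ContextualityScenario

/-! ### Quantum models -/

/-- The norm is monotone on positive elements and `0 ≤ ‖a‖ - a ≤ ‖a‖`. The factor `‖1‖` allows for
the zero algebra. This turns positivity into a norm bound, which can be carried from `C*(G)` to a
representation of the free algebra. -/
theorem CStarAlgebra.norm_algebraMap_norm_sub_le {A : Type*} [CStarAlgebra A] [PartialOrder A]
    [StarOrderedRing A] {a : A} (ha : 0 ≤ a) : ‖algebraMap ℝ A ‖a‖ - a‖ ≤ ‖a‖ * ‖(1 : A)‖ := by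
  have h1 : a ≤ algebraMap ℝ A ‖a‖ := (IsSelfAdjoint.of_nonneg ha).le_algebraMap_norm_self
  refine (CStarAlgebra.norm_le_norm_of_nonneg_of_le (sub_nonneg.2 h1)
    (sub_le_self _ ha)).trans ?_
  rw [norm_algebraMap, norm_norm]

namespace ContextualityScenario

open OperatorSystem

variable {V : Type u} (G : ContextualityScenario V)

/-- Only an inequality, since `C*(G)` may be the zero algebra. -/
theorem CStar.norm_one_le : ‖(1 : G.CStar)‖ ≤ 1 := by
  rw [← map_one CStar.ofFree, CStar.norm_ofFree]
  refine FreeStarAlg.univNorm_le zero_le_one fun R => ?_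
  rw [map_one]
  exact ContinuousLinearMap.norm_id_le

variable {G} in
/-- Elements of the free *-algebra that are positive in `C*(G)` are positive in every projective
representation. -/
theorem CStar.re_inner_eval_nonneg {α : G.FreeStarAlg} {b : G.CStar}
    (h : CStar.ofFree α = star b * b) (R : G.ProjRep) (ψ : R.H) :
    0 ≤ (inner ℂ ψ (FreeStarAlg.eval R α ψ)).re := by
  let _ := CStarAlgebra.spectralOrder G.CStar
  have _ := CStarAlgebra.spectralOrderedRing G.CStar
  have h0 : 0 ≤ (CStar.ofFree α : G.CStar) := h ▸ star_mul_self_nonneg b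
  have h1 := CStarAlgebra.norm_algebraMap_norm_sub_le h0
  set r := ‖(CStar.ofFree α : G.CStar)‖
  have h2 : algebraMap ℝ G.CStar r - CStar.ofFree α = CStar.ofFree ((r : ℂ) • 1 - α) := by
    rw [map_sub, map_smul, map_one, Algebra.algebraMap_eq_smul_one, Complex.coe_smul]
  rw [h2, CStar.norm_ofFree] at h1
  -- The universal norm dominates the norm in every representation, so `R` need not be extended to
  -- the completion. The bound gives `⟨ψ, (r - α) ψ⟩ ≤ r ‖ψ‖ ^ 2` in real part, which is the claim.
  have h3 : ‖FreeStarAlg.eval R ((r : ℂ) • 1 - α)‖ ≤ r :=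
    (FreeStarAlg.le_univNorm R _).trans (h1.trans
      (mul_le_of_le_one_right (norm_nonneg _) (CStar.norm_one_le G)))
  have h4 : (inner ℂ ψ (FreeStarAlg.eval R ((r : ℂ) • 1 - α) ψ)).re ≤ r * ‖ψ‖ ^ 2 := by
    refine (Complex.re_le_norm _).trans ((norm_inner_le_norm _ _).trans ?_)
    have h5 := ContinuousLinearMap.le_of_opNorm_le _ h3 ψ
    nlinarith [norm_nonneg ψ]
  rw [map_sub, map_smul, map_one, sub_apply, smul_apply,
    one_apply_eq_self, inner_sub_right, inner_smul_right, inner_self_eq_norm_sq_to_K,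
    Complex.sub_re] at h4
  have h6 : ((r : ℂ) * ((‖ψ‖ : ℂ)) ^ 2).re = r * ‖ψ‖ ^ 2 := by
    rw [← Complex.ofReal_pow, ← Complex.ofReal_mul, Complex.ofReal_re]
  have h7 : ((r : ℂ) * ((‖ψ‖ : ℂ)) ^ 2).re - (inner ℂ ψ (FreeStarAlg.eval R α ψ)).re ≤
    r * ‖ψ‖ ^ 2 := h4
  linarith

/-- The projective representation given by a representation of `C*(G)`. -/
noncomputable def ProjRep.ofStarAlgHom {H : Type u} [NormedAddCommGroup H] [InnerProductSpace ℂ H]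
    [CompleteSpace H] (π : G.CStar →⋆ₐ[ℂ] (H →L[ℂ] H)) : G.ProjRep where
  H := H
  P x := π (CStar.p x)
  proj x := (CStar.isStarProjection_p x).map π
  sum_eq e he := by rw [← map_sum, CStar.sum_p he, map_one]

/-- States of `C*(G)` induce quantum models, by the Gelfand-Naimark-Segal construction. -/
theorem mem_quantumModels_of_state [PartialOrder G.CStar] [StarOrderedRing G.CStar]
    (f : G.CStar →ₚ[ℂ] ℂ) (hf : f 1 = 1) {p : V → ℝ} (hp : ∀ x, f (CStar.p x) = p x) :
    p ∈ G.quantumModels := by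
  -- The cyclic vector is the class of the unit: its squared norm is `f 1`, and its matrix
  -- coefficient at `a` is `f a`.
  refine ⟨ProjRep.ofStarAlgHom G f.gnsStarAlgHom, ((f.toPreGNS 1 : f.PreGNS) : f.GNS), ?_,
    fun x => ?_⟩
  · have h1 := f.preGNS_norm_sq (f.toPreGNS 1)
    rw [PositiveLinearMap.ofPreGNS_toPreGNS, star_one, one_mul, hf] at h1
    have h2 : ‖f.toPreGNS 1‖ ^ 2 = 1 := by exact_mod_cast h1
    refine (UniformSpace.Completion.norm_coe (f.toPreGNS 1)).trans ?_
    exact (pow_eq_one_iff_of_nonneg (norm_nonneg _) two_ne_zero).1 h2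
  · rw [← hp x]
    change _ = inner ℂ ((f.toPreGNS 1 : f.PreGNS) : f.GNS)
      (f.gnsNonUnitalStarAlgHom (CStar.p x) ((f.toPreGNS 1 : f.PreGNS) : f.GNS))
    rw [PositiveLinearMap.gnsNonUnitalStarAlgHom_apply_coe, UniformSpace.Completion.inner_coe,
      PositiveLinearMap.preGNS_inner_def]
    simp

/-! ### Quantum models as the models that are positive on `T`. -/

variable [Fintype V]

theorem isGenerating_T : G.IsGenerating G.T.toAOUSpace G.p where
  span_eq_top := span_range_gen _ _
  mem_cone x := (mem_subsystem_cone_iff _).2 ⟨CStar.p x, by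
    rw [G.star_p, (CStar.isStarProjection_p x).isIdempotentElem]
    rfl⟩
  sum_eq e he := SelfAdjSpan.incl_injective (by
    rw [map_sum]
    exact CStar.sum_p he)

theorem mem_coeffCone_T_iff (c : V → ℝ) : c ∈ coeffCone G.T.toAOUSpace G.p ↔
    ∃ b : G.CStar, realComb CStar.p c = star b * b := by
  refine (mem_subsystem_cone_iff (h1 := G.one_mem_span_p) (realComb G.p c)).trans ?_
  have : SelfAdjSpan.incl _ _ (realComb G.p c) = realComb (CStar.p (G := G)) c := by
    simp only [realComb_apply, map_sum, map_smul]
    rfl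
  rw [this]

theorem quantumModels_subset_models : G.quantumModels ⊆ G.models := by
  rintro p ⟨R, ψ, hψ, hp⟩
  refine G.mem_models_of_nonneg (fun x => ?_) fun e he => ?_
  -- For a projection the value is `‖P ψ‖ ^ 2`, hence non-negative.
  · have h1 : inner ℂ ψ (R.P x ψ) = inner ℂ (R.P x ψ) (R.P x ψ) := by
      have h2 := (R.proj x).isSelfAdjoint
      have h3 := (R.proj x).isIdempotentElem
      conv_lhs => rw [← h3, mul_apply_eq_comp]
      rw [← ContinuousLinearMap.adjoint_inner_left, h2.adjoint_eq]
    have h4 : (p x : ℂ) = ((‖R.P x ψ‖ ^ 2 : ℝ) : ℂ) := by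
      rw [hp x, h1, inner_self_eq_norm_sq_to_K]
      simp
    rw [Complex.ofReal_injective h4]
    positivity
  · have h1 : (∑ x ∈ e, (p x : ℂ)) = 1 := by
      simp only [hp]
      rw [← inner_sum, ← sum_apply, R.sum_eq e he,
        one_apply_eq_self, inner_self_eq_norm_sq_to_K, hψ]
      simp
    exact_mod_cast h1

theorem quantumModels_subset_dualModels :
    G.quantumModels ⊆ G.dualModels G.T.toAOUSpace G.p := fun p hp => by
  refine ⟨G.quantumModels_subset_models hp, fun c hc => ?_⟩
  obtain ⟨b, hb⟩ := (G.mem_coeffCone_T_iff c).1 hc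
  obtain ⟨R, ψ, hψ, hp⟩ := hp
  have h1 : realComb CStar.p c = CStar.ofFree (∑ x, (c x : ℂ) • FreeStarAlg.gen (G := G) x) := by
    simp only [realComb_apply, map_sum, map_smul, CStar.p]
  have h2 := CStar.re_inner_eval_nonneg (h1.symm.trans hb) R ψ
  have h3 : inner ℂ ψ (FreeStarAlg.eval R (∑ x, (c x : ℂ) • FreeStarAlg.gen (G := G) x) ψ) =
      (dot p c : ℂ) := by
    simp only [map_sum, map_smul, FreeStarAlg.eval_gen, sum_apply,
      smul_apply, inner_sum, inner_smul_right, ← hp, dot_apply]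
    push_cast
    rfl
  rwa [h3, Complex.ofReal_re] at h2

/-- Functionals that are positive on `T_G` extend to real linear functionals on `C*(G)` that are
positive on elements with positive real part. -/
theorem exists_extension [PartialOrder G.CStar] [StarOrderedRing G.CStar] {p : V → ℝ}
    (hp : ∀ c ∈ coeffCone G.T.toAOUSpace G.p, 0 ≤ dot p c) :
    ∃ g : G.CStar →ₗ[ℝ] ℝ, (∀ c, g (realComb CStar.p c) = dot p c) ∧
      ∀ a, 0 ≤ a + star a → 0 ≤ g a := by
  have hstar : ∀ c, star (realComb (CStar.p (G := G)) c) = realComb CStar.p c := fun c => by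
    simp [realComb_apply, star_sum, star_smul, G.star_p]
  -- The functional `dot p` lives on coefficients, and the projections `p x` may be linearly
  -- dependent. Working on pairs avoids defining it on their span: a pair stands for `∑ c x • p x +
  -- a`, and lies in `K` when this has positive real part.
  let K : PointedCone ℝ ((V → ℝ) × G.CStar) :=
    { carrier := {y | 0 ≤ (realComb CStar.p y.1 + y.2) + star (realComb CStar.p y.1 + y.2)}
      add_mem' := fun {y z} hy hz => by
        refine (add_nonneg hy hz).trans_eq ?_
        simp only [Prod.fst_add, Prod.snd_add, map_add, star_add]
        abel
      zero_mem' := by simp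
      smul_mem' := fun r y hy => by
        refine (smul_nonneg r.2 hy).trans_eq ?_
        change (r : ℝ) • _ = realComb CStar.p ((r : ℝ) • y.1) + (r : ℝ) • y.2 +
          star (realComb CStar.p ((r : ℝ) • y.1) + (r : ℝ) • y.2)
        rw [map_smul, ← smul_add, star_smul, star_trivial (r : ℝ), smul_add (r : ℝ)] }
  have hK : ∀ y, y ∈ K ↔
    0 ≤ (realComb CStar.p y.1 + y.2) + star (realComb CStar.p y.1 + y.2) := fun y => Iff.rfl
  let f : (V → ℝ) × G.CStar →ₗ.[ℝ] ℝ :=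
    { domain := LinearMap.ker (LinearMap.snd ℝ (V → ℝ) G.CStar)
      toFun := dot p ∘ₗ LinearMap.fst ℝ (V → ℝ) G.CStar ∘ₗ Submodule.subtype _ }
  have hdom : ∀ c : V → ℝ, (c, (0 : G.CStar)) ∈ f.domain := fun c => rfl
  have hnonneg : ∀ x : f.domain, (x : (V → ℝ) × G.CStar) ∈ K → 0 ≤ f x := by
    rintro ⟨⟨c, a⟩, ha⟩ hc
    change a = 0 at ha
    subst ha
    refine hp c ((G.mem_coeffCone_T_iff c).2 (CStarAlgebra.nonneg_iff_eq_star_mul_self.1 ?_))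
    have h1 := (hK _).1 hc
    simp only [add_zero, hstar] at h1
    have h2 := smul_nonneg (show (0 : ℝ) ≤ 1 / 2 by norm_num) h1
    rwa [← two_smul ℝ, smul_smul, one_div, inv_mul_cancel₀ two_ne_zero, one_smul] at h2
  have hdense : ∀ y, ∃ x : f.domain, (x : (V → ℝ) × G.CStar) + y ∈ K := by
    rintro ⟨c, a⟩
    obtain ⟨e, he⟩ := G.edges_nonempty
    obtain ⟨b, hb⟩ : ∃ b, b = realComb CStar.p c + a := ⟨_, rfl⟩
    -- The indicator of a hyperedge represents the unit, so this adds the norm of `b + star b` as a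
    -- scalar; taking `y + star y` doubles it, more than enough for positivity.
    refine ⟨⟨(‖b + star b‖ • indic e, 0), hdom _⟩, ?_⟩
    have h1 := (IsSelfAdjoint.add_star_self b).neg_algebraMap_norm_le_self
    have h2 : (0 : G.CStar) ≤ algebraMap ℝ _ ‖b + star b‖ :=
      algebraMap_nonneg _ (norm_nonneg _)
    rw [neg_le_iff_add_nonneg] at h1
    have h3 := add_nonneg h1 h2
    rw [hK]
    convert h3 using 1
    have h4 : realComb CStar.p (‖b + star b‖ • indic e) = algebraMap ℝ G.CStar ‖b + star b‖ := by
      rw [map_smul, realComb_indic, CStar.sum_p he, Algebra.algebraMap_eq_smul_one]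
    have h5 : star (algebraMap ℝ G.CStar ‖b + star b‖) = algebraMap ℝ G.CStar ‖b + star b‖ := by
      rw [← h4, hstar]
    simp only [Prod.mk_add_mk, zero_add, map_add, h4]
    rw [add_assoc _ (realComb CStar.p c) a, ← hb, star_add, h5]
    abel
  obtain ⟨g, hgf, hg⟩ := riesz_extension K f hnonneg hdense
  have h0 : ∀ c, g (c, 0) = dot p c := fun c => hgf ⟨(c, 0), hdom c⟩
  refine ⟨g ∘ₗ LinearMap.inr ℝ (V → ℝ) G.CStar, fun c => ?_, fun a ha => ?_⟩
  -- These two pairs represent zero and are opposite to each other, so `g` vanishes on both. Thus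
  -- `g` identifies a coefficient vector with the element it represents.
  · have h1 : 0 ≤ g (-c, realComb CStar.p c) := hg _ (by simp [hK])
    have h2 : 0 ≤ g (c, -realComb CStar.p c) := hg _ (by simp [hK])
    have h3 : g (-c, realComb CStar.p c) + g (c, 0) = g (0, realComb CStar.p c) := by
      rw [← map_add]
      simp
    have h4 : g (c, -realComb CStar.p c) + g (0, realComb CStar.p c) = g (c, 0) := by
      rw [← map_add]
      simp
    change g (0, realComb CStar.p c) = _
    rw [h0] at h3 h4
    linarith
  · exact hg _ (by simpa [hK] using ha)

theorem dualModels_T : G.dualModels G.T.toAOUSpace G.p = G.quantumModels := by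
  classical
  refine Set.Subset.antisymm (fun p hp => ?_) G.quantumModels_subset_dualModels
  let _ := CStarAlgebra.spectralOrder G.CStar
  have _ := CStarAlgebra.spectralOrderedRing G.CStar
  obtain ⟨g, hgp, hg⟩ := G.exists_extension hp.2
  -- Both `a` and `-a` have zero real part, so `g` is non-negative on both. Hence the
  -- complexification `a ↦ g a - i g (i a)` agrees with `g` on self-adjoint elements, and is
  -- positive.
  have hskew : ∀ a : G.CStar, star a = -a → g a = 0 := fun a ha => by
    have h1 := hg a (by rw [ha, add_neg_cancel])
    have h2 := hg (-a) (by rw [star_neg, ha, neg_neg, neg_add_cancel])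
    rw [map_neg] at h2
    linarith
  have hsa : ∀ a : G.CStar, star a = a → Module.Dual.extendRCLike (𝕜 := ℂ) g a = (g a : ℂ) := fun a ha => by
    rw [Module.Dual.extendRCLike_apply]
    have h1 : g ((RCLike.I : ℂ) • a) = 0 := hskew _ (by
      rw [star_smul, ha, RCLike.star_def, RCLike.conj_I, neg_smul])
    rw [h1]
    simp
  let f : G.CStar →ₚ[ℂ] ℂ :=
    { toLinearMap := Module.Dual.extendRCLike (𝕜 := ℂ) g
      monotone' := fun a b hab => by
        have h0 := sub_nonneg.2 hab
        have h1 : star (b - a) = b - a := (IsSelfAdjoint.of_nonneg h0).star_eq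
        change Module.Dual.extendRCLike (𝕜 := ℂ) g a ≤ Module.Dual.extendRCLike (𝕜 := ℂ) g b
        rw [← sub_nonneg, ← map_sub, hsa _ h1]
        exact Complex.zero_le_real.2 (hg _ (by rw [h1]; exact add_nonneg h0 h0)) }
  have hf : ∀ a, star a = a → f a = g a := hsa
  refine G.mem_quantumModels_of_state f ?_ fun x => ?_
  · obtain ⟨e, he⟩ := G.edges_nonempty
    rw [hf 1 (star_one _), ← CStar.sum_p he, ← realComb_indic, hgp, dot_indic, hp.1.2 e he,
      Complex.ofReal_one]
  · rw [hf _ (G.star_p x), ← realComb_single CStar.p x, hgp, dot_single]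

end ContextualityScenario

/-! ### The three equivalences. -/

theorem mainTheorem11 {V : Type u} [Finite V] (G : ContextualityScenario V)
    (hG : G.models.Nonempty) :
    (G.models = G.quantumModels ↔ OperatorSystem.CanonicallyEq G.S.OMIN G.T.OMIN G.a G.p) ∧
    (G.quantumModels = G.classicalModels ↔ OperatorSystem.CanonicallyEq G.T.OMIN G.R G.p G.d) ∧
    (G.classicalModels = G.models ↔ OperatorSystem.CanonicallyEq G.R G.S.OMIN G.d G.a) := by
  cases nonempty_fintype V
  -- With `R` written as its own `OMIN`, all three equalities are instances of
  -- `IsGenerating.canonicallyEq_iff`.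
  rw [← G.OMIN_R]
  simp only [OperatorSystem.OMIN, G.isGenerating_S.canonicallyEq_iff G.isGenerating_T,
    G.isGenerating_T.canonicallyEq_iff G.isGenerating_R,
    G.isGenerating_R.canonicallyEq_iff G.isGenerating_S, G.dualModels_S, G.dualModels_T,
    G.dualModels_R, and_self]
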